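/- All spaces are Hausdorff, $I=[0,1]$, and $\Omega^n(Z,z)$ is the set of $n$-loops, i.e. continuous maps $f:I^n\to Z$ with $f(\partial I^n)\subseteq\{z\}$ (for $n=0$: points of $Z$). A sequence of maps $f_m:K\to Z$ \emph{converges to} $z\in Z$ if every neighborhood of $z$ contains the image of $f_m$ for all but finitely many $m$. Two sequences $\{f_m\},\{g_m\}$ of maps $K\to Z$ converging to $z$ are \emph{sequentially homotopic} (rel. $S\subseteq K$) if there are homotopies $H_m:K\times I\to Z$ from $f_m$ to $g_m$ (constant on $S$) such that $\{H_m\}$ converges to $z$. Let $\mathbb{H}_k$ be the $k$-dimensional Hawaiian earring: the one-point union of countably many $k$-spheres, with wedge point $b_0$, in which $U$ is open iff $U$ meets each sphere in an open set and, if $b_0\in U$, contains all but finitely many of the spheres. A space $Z$ is \emph{sequentially $n$-connected at} $z$ if the set $[(\mathbb{H}_k,b_0),(Z,z)]$ of pointed homotopy classes is trivial for all $0\le k\le n$. Let $X$ be a space, $\{x_j\}_{j\in\mathbb{N}}$ a sequence of (not necessarily distinct) points of $X$, and $\{(A_j,a_j)\}_{j\in\mathbb{N}}$ a sequence of based spaces.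 Let $Y_k$ be the adjunction space obtained from $X$ by attaching the first $k$ of the spaces $A_j$ along $a_j\sim x_j$, with the quotient topology. The \emph{shrinking adjunction space} $Y=\mathbf{Adj}(X,x_j,A_j,a_j)$ is the inverse limit of the spaces $Y_k$ under the retractions $Y_{k+1}\to Y_k$ that collapse the last attached space to its attachment point. View $X$ as a subspace of $Y$, and let $r:Y\to X$ be the canonical retraction, which collapses each $A_j$ to $x_j$. \textbf{Theorem.} Let $n\ge 0$, let $Y=\mathbf{Adj}(X,x_j,A_j,a_j)$ where each $A_j$ is sequentially $n$-connected at $a_j$, and let $y_0\in X$. \begin{enumerate} \item Every sequence $\{f_m\}_{m\in\mathbb{N}}$ in $\Omega^n(Y,y_0)$ that converges to $y_0$ is sequentially homotopic rel. $\partial I^n$ to $\{r\circ f_m\}_{m\in\mathbb{N}}$. \item If $X$ is sequentially $n$-connected at $y_0$, then $Y$ is sequentially $n$-connected at $y_0$. \item For all $0\le m\le n$ the map $r_\#:\pi_m(Y,y_0)\to\pi_m(X,y_0)$ induced by $r$ is an isomorphism (a bijection for $m=0$, an isomorphism of groups for $m\ge 1$). \end{enumerate} -/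

import Mathlib

open Filter Topology
open scoped unitInterval

noncomputable section

/-! ### Sequential homotopy -/

/-- A sequence of maps `f m : K → Y` converges to the point `y` if every neighbourhood of `y`
contains the image of `f m` for all but finitely many `m`. -/
def ConvergesToPoint {K Y : Type*} [TopologicalSpace K] [TopologicalSpace Y]
    (f : ℕ → C(K, Y)) (y : Y) : Prop :=
  ∀ U ∈ 𝓝 y, ∀ᶠ m in atTop, Set.range (f m) ⊆ U

/-- Two sequences of maps `K → Y` that converge to `y` are sequentially homotopic rel. `S` if there
are homotopies `H m : I × K → Y` from `f m` to `g m`, each constant on `S`, such that the sequence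
`H` converges to `y` as well. (For `S = ∅` these are free homotopies.) -/
def SequentiallyHomotopicRel {K Y : Type*} [TopologicalSpace K] [TopologicalSpace Y]
    (S : Set K) (f g : ℕ → C(K, Y)) (y : Y) : Prop :=
  ConvergesToPoint f y ∧ ConvergesToPoint g y ∧
    ∃ H : ∀ m : ℕ, ContinuousMap.HomotopyRel (f m) (g m) S,
      ConvergesToPoint (fun m => ((H m).toContinuousMap : C(I × K, Y))) y

/-! ### Pointed homotopy classes -/

/-- Based maps `(X, x) → (Y, y)`. -/
def BasedMap (X : Type*) [TopologicalSpace X] (x : X) (Y : Type*) [TopologicalSpace Y] (y : Y) :=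
  {f : C(X, Y) // f x = y}

/-- Homotopy of based maps through based maps. -/
def basedHomotopySetoid (X : Type*) [TopologicalSpace X] (x : X)
    (Y : Type*) [TopologicalSpace Y] (y : Y) : Setoid (BasedMap X x Y y) where
  r f g := ContinuousMap.HomotopicRel f.1 g.1 {x}
  iseqv := ⟨fun f => ContinuousMap.HomotopicRel.refl f.1, fun h => h.symm, fun h k => h.trans k⟩

/-- The set `[(X, x), (Y, y)]` of pointed homotopy classes of based maps. -/
def PointedHomotopyClasses (X : Type*) [TopologicalSpace X] (x : X)
    (Y : Type*) [TopologicalSpace Y] (y : Y) :=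
  Quotient (basedHomotopySetoid X x Y y)

/-! ### Shrinking wedges and Hawaiian earrings -/

/-- The relation identifying all base points in a disjoint union. -/
inductive WedgeRel (A : ℕ → Type*) (a : ∀ j, A j) : (Σ j, A j) → (Σ j, A j) → Prop
  | glue (i j : ℕ) : WedgeRel A a ⟨i, a i⟩ ⟨j, a j⟩

/-- The underlying set of the shrinking wedge of a sequence of based spaces: the one-point union. -/
def ShrinkingWedge (A : ℕ → Type*) (a : ∀ j, A j) := Quot (WedgeRel A a)

namespace ShrinkingWedge

/-- The canonical map from the `j`-th wedge summand. -/
def incl (A : ℕ → Type*) (a : ∀ j, A j) (j : ℕ) (p : A j) : ShrinkingWedge A a :=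
  Quot.mk (WedgeRel A a) ⟨j, p⟩

/-- The wedge point. -/
def base (A : ℕ → Type*) (a : ∀ j, A j) : ShrinkingWedge A a := incl A a 0 (a 0)

/-- `U` is open iff it meets every summand in an open set and, if it contains the wedge point,
contains all but finitely many summands. -/
instance instTopologicalSpace (A : ℕ → Type*) [∀ j, TopologicalSpace (A j)] (a : ∀ j, A j) :
    TopologicalSpace (ShrinkingWedge A a) where
  IsOpen U := (∀ j, IsOpen (incl A a j ⁻¹' U)) ∧
    (base A a ∈ U → {j | ¬ Set.range (incl A a j) ⊆ U}.Finite)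
  isOpen_univ := ⟨fun j => by simp, fun _ => by simp⟩
  isOpen_inter U V hU hV := by
    refine ⟨fun j => (hU.1 j).inter (hV.1 j), fun h => ?_⟩
    refine ((hU.2 h.1).union (hV.2 h.2)).subset fun j hj => ?_
    by_contra hcon
    simp only [Set.mem_union, Set.mem_ofPred_eq, not_or, not_not] at hcon
    exact hj (Set.subset_inter hcon.1 hcon.2)
  isOpen_sUnion S hS := by
    refine ⟨fun j => ?_, ?_⟩
    · rw [Set.preimage_sUnion]
      exact isOpen_biUnion fun U hU => (hS U hU).1 j
    · rintro ⟨U, hU, hb⟩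
      exact ((hS U hU).2 hb).subset fun j hj hjU => hj (hjU.trans (Set.subset_sUnion_of_mem hU))

end ShrinkingWedge

/-- The unit sphere `S^n` in `ℝ^(n+1)`. -/
abbrev UnitSphere (n : ℕ) : Type := Metric.sphere (0 : EuclideanSpace ℝ (Fin (n + 1))) 1

/-- The base point `(1, 0, …, 0)` of `S^n`. -/
def UnitSphere.base (n : ℕ) : UnitSphere n :=
  ⟨EuclideanSpace.single 0 1, by simp⟩

/-- The `n`-dimensional Hawaiian earring: the shrinking wedge of countably many `n`-spheres. -/
abbrev HawaiianEarring (n : ℕ) : Type :=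
  ShrinkingWedge (fun _ : ℕ => UnitSphere n) (fun _ => UnitSphere.base n)

/-- The wedge point of the `n`-dimensional Hawaiian earring. -/
abbrev HawaiianEarring.base (n : ℕ) : HawaiianEarring n :=
  ShrinkingWedge.base (fun _ : ℕ => UnitSphere n) (fun _ => UnitSphere.base n)

/-- `X` is sequentially `n`-connected at `x` if `[(ℍ_k, b₀), (X, x)]` is trivial for `0 ≤ k ≤ n`.
(This set always contains the class of the constant map.) -/
def SequentiallyConnectedAt (n : ℕ) (X : Type*) [TopologicalSpace X] (x : X) : Prop :=
  ∀ k ≤ n, Subsingleton (PointedHomotopyClasses (HawaiianEarring k) (HawaiianEarring.base k) X x)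

/-! ### Shrinking adjunction spaces -/

/-- The relation identifying `a j` with `x j` for `j < k`. -/
inductive AdjRel {X : Type*} (x : ℕ → X) (A : ℕ → Type*) (a : ∀ j, A j) (k : ℕ) :
    (X ⊕ Σ j : Fin k, A j) → (X ⊕ Σ j : Fin k, A j) → Prop
  | glue (j : Fin k) : AdjRel x A a k (Sum.inl (x j)) (Sum.inr ⟨j, a j⟩)

/-- The ordinary adjunction space obtained from `X` by attaching `A j` along `a j ∼ x j` for
`j < k`, with the quotient topology. -/
abbrev FiniteAdj {X : Type*} (x : ℕ → X) (A : ℕ → Type*) (a : ∀ j, A j) (k : ℕ) :=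
  Quot (AdjRel x A a k)

namespace FiniteAdj

/-- The retraction that collapses the last attached space to its attachment point and is the
identity elsewhere. -/
def collapse {X : Type*} (x : ℕ → X) (A : ℕ → Type*) (a : ∀ j, A j) (k : ℕ) :
    FiniteAdj x A a (k + 1) → FiniteAdj x A a k :=
  Quot.lift
    (Sum.elim (fun p => Quot.mk _ (Sum.inl p))
      (fun q => if h : (q.1 : ℕ) < k then Quot.mk _ (Sum.inr ⟨⟨q.1, h⟩, q.2⟩)
        else Quot.mk _ (Sum.inl (x q.1))))
    (by
      rintro _ _ ⟨j⟩
      by_cases h : (j : ℕ) < k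
      · simpa [h] using Quot.sound (AdjRel.glue (x := x) (a := a) (⟨j, h⟩ : Fin k))
      · simp [h])

/-- The retraction onto `X` that collapses every attached space to its attachment point. -/
def toCore {X : Type*} [TopologicalSpace X] (x : ℕ → X) (A : ℕ → Type*)
    [∀ j, TopologicalSpace (A j)] (a : ∀ j, A j) (k : ℕ) : C(FiniteAdj x A a k, X) where
  toFun := Quot.lift (Sum.elim id (fun q => x q.1)) (by rintro _ _ ⟨j⟩; rfl)
  continuous_toFun := by
    refine continuous_quot_lift _ ?_
    exact continuous_id.sumElim (continuous_sigma fun j => (continuous_const : Continuous fun _ : A j => x j))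

end FiniteAdj

/-- The shrinking adjunction space `Adj(X, x_j, A_j, a_j)`: the inverse limit of the ordinary
adjunction spaces under the collapsing retractions, as a subspace of the direct product. -/
abbrev ShrinkingAdj {X : Type*} (x : ℕ → X) (A : ℕ → Type*) (a : ∀ j, A j) :=
  {y : ∀ k, FiniteAdj x A a k // ∀ k, FiniteAdj.collapse x A a k (y (k + 1)) = y k}

namespace ShrinkingAdj

/-- The inclusion of the core `X`. -/
def core {X : Type*} [TopologicalSpace X] (x : ℕ → X) (A : ℕ → Type*)
    [∀ j, TopologicalSpace (A j)] (a : ∀ j, A j) : C(X, ShrinkingAdj x A a) where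
  toFun p := ⟨fun _ => Quot.mk _ (Sum.inl p), fun _ => rfl⟩
  continuous_toFun := Continuous.subtype_mk
    (continuous_pi fun _ => continuous_quot_mk.comp continuous_inl) _

/-- The `k`-th projection followed by the retraction onto `X` does not depend on `k`. -/
theorem toCore_eq {X : Type*} [TopologicalSpace X] (x : ℕ → X) (A : ℕ → Type*)
    [∀ j, TopologicalSpace (A j)] (a : ∀ j, A j) (y : ShrinkingAdj x A a) (k : ℕ) :
    FiniteAdj.toCore x A a k (y.1 k) = FiniteAdj.toCore x A a 0 (y.1 0) := by
  induction k with
  | zero => rfl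
  | succ k ih =>
    rw [← ih, ← y.2 k]
    generalize y.1 (k + 1) = z
    obtain ⟨p | ⟨j, p⟩⟩ := z
    · rfl
    · by_cases h : (j : ℕ) < k <;> simp [FiniteAdj.collapse, FiniteAdj.toCore, h]

/-- The canonical retraction `r` onto the core, collapsing every `A j` to `x j`. -/
def retraction {X : Type*} [TopologicalSpace X] (x : ℕ → X) (A : ℕ → Type*)
    [∀ j, TopologicalSpace (A j)] (a : ∀ j, A j) : C(ShrinkingAdj x A a, X) where
  toFun y := FiniteAdj.toCore x A a 0 (y.1 0)
  continuous_toFun := (FiniteAdj.toCore x A a 0).continuous.comp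
    ((continuous_apply 0).comp continuous_subtype_val)

theorem retraction_core {X : Type*} [TopologicalSpace X] (x : ℕ → X) (A : ℕ → Type*)
    [∀ j, TopologicalSpace (A j)] (a : ∀ j, A j) (p : X) :
    retraction x A a (core x A a p) = p := rfl

end ShrinkingAdj

/-! ### Induced maps on homotopy groups -/

/-- The `n`-loop `h ∘ f`. -/
def GenLoop.postcomp {N X Y : Type*} [TopologicalSpace X] [TopologicalSpace Y] {x : X} {y : Y}
    (h : C(X, Y)) (hxy : h x = y) (f : GenLoop N X x) : GenLoop N Y y :=
  ⟨h.comp f.1, fun t ht => by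
    rw [ContinuousMap.comp_apply, f.2 t ht, hxy]⟩

/-- The map `π_m(X, x) → π_m(Y, y)`, `[f] ↦ [h ∘ f]`, induced by a based map `h`. -/
def HomotopyGroup.induced {X Y : Type*} [TopologicalSpace X] [TopologicalSpace Y] {x : X} {y : Y}
    (h : C(X, Y)) (hxy : h x = y) (m : ℕ) : HomotopyGroup.Pi m X x → HomotopyGroup.Pi m Y y :=
  Quotient.map (GenLoop.postcomp h hxy) (fun _ _ hfg => ContinuousMap.HomotopicRel.comp_continuousMap hfg h)

end

noncomputable section

/-! ### Coordinates on shrinking adjunction spaces -/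

/-! A point of `Y` is determined by its image under `r` and by its coordinates in the spaces `A j`.
This identifies `Y`, topology included, with the subspace `AdjCoords` of `X × ∏ A j` in which at
most one coordinate differs from its base point, and then only over `x j` (`coordsHomeomorph`). A
deformation of `Y` into `X` can therefore be built separately in each `A j`. If each coordinate is
contracted relative to the preimage of `a j`, no new nontrivial coordinate appears, so the combined
path stays in `AdjCoords`. Continuity and convergence are checked coordinatewise, with no uniformity
in `j` (`exists_homotopy_core`).

The main point is thus a contraction relative to an arbitrary closed set
(`exists_nullhomotopy_rel`): a map `G` from `ℕ × ℝⁿ` to a sequentially `n`-connected `A`, tending to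
`a` at infinity, contracts relative to `G⁻¹(a)`. The open complement `U` of that preimage is
decomposed into dyadic cells, arbitrarily fine near the frontier of `U`. By induction on dimension,
the homotopy is prescribed on the boundary sphere of each cylinder over a `k`-cell. These spheres
are countably many and converge to `a`, hence form a map of the `k`-dimensional Hawaiian earring.
Its contraction fills all cylinders at once, with fillings still converging to `a`
(`exists_extension`). This convergence makes the extension by `a` outside `U` continuous.

Cubes and spheres are compactifications of `ℝⁿ`, so one argument serves both loops and Hawaiian
earrings. All three claims follow from the deformation together with the fact that `r` restricts to
the identity on `X`. -/

theorem convergesToPoint_iff_tendsto {K Y : Type*} [TopologicalSpace K] [TopologicalSpace Y]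
    (f : ℕ → C(K, Y)) (y : Y) :
    ConvergesToPoint f y ↔
      Tendsto (fun q : ℕ × K => f q.1 q.2) (atTop ×ˢ (⊤ : Filter K)) (𝓝 y) := by
  constructor
  · intro h U hU
    rw [mem_map, mem_prod_top]
    filter_upwards [h U hU] with m hm t using hm ⟨t, rfl⟩
  · intro h U hU
    have := h hU
    rw [mem_map, mem_prod_top] at this
    filter_upwards [this] with m hm
    rintro _ ⟨t, rfl⟩
    exact hm t

/-- The set of coordinate tuples of points of a shrinking adjunction space. -/
def AdjCoords {X : Type*} (x : ℕ → X) (A : ℕ → Type*) (a : ∀ j, A j) : Set (X × ∀ j, A j) :=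
  {c | ∀ j, c.2 j ≠ a j → c.1 = x j ∧ ∀ i, i ≠ j → c.2 i = a i}

namespace FiniteAdj

variable {X : Type*} (x : ℕ → X) (A : ℕ → Type*) (a : ∀ j, A j)

/-- The retraction onto the attached space `A j`, collapsing everything else to `a j`. -/
def coord (k j : ℕ) : FiniteAdj x A a k → A j :=
  Quot.lift (Sum.elim (fun _ => a j) (fun q => if h : (q.1 : ℕ) = j then h ▸ q.2 else a j))
    (by
      rintro _ _ ⟨i⟩
      by_cases h : (i : ℕ) = j
      · subst h; simp
      · simp [h])

theorem continuous_coord [TopologicalSpace X] [∀ j, TopologicalSpace (A j)] (k j : ℕ) :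
    Continuous (coord x A a k j) := by
  refine continuous_quot_lift _ (continuous_const.sumElim (continuous_sigma fun i => ?_))
  by_cases h : (i : ℕ) = j
  · subst h; simpa using continuous_id'
  · simpa [h] using continuous_const

theorem coord_collapse (k j : ℕ) (hj : j < k) (z : FiniteAdj x A a (k + 1)) :
    coord x A a k j (collapse x A a k z) = coord x A a (k + 1) j z := by
  obtain ⟨p | ⟨i, p⟩⟩ := z
  · rfl
  · by_cases h : (i : ℕ) < k
    · simp [coord, collapse, h]
    · have : (i : ℕ) ≠ j := by omega
      simp [coord, collapse, h, this]

open Classical in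
/-- The point of the `k`-th adjunction space with given coordinates. -/
def ofCoords (k : ℕ) (c : X × ∀ j, A j) : FiniteAdj x A a k :=
  if h : ∃ j : Fin k, c.2 j ≠ a j then Quot.mk _ (Sum.inr ⟨h.choose, c.2 h.choose⟩)
  else Quot.mk _ (Sum.inl c.1)

variable {x A a}

/-- On `AdjCoords` the nontrivial coordinate is unique, so the choice made in `ofCoords` is forced.
-/
theorem ofCoords_of_ne {k : ℕ} {c : X × ∀ j, A j} (hc : c ∈ AdjCoords x A a) (j : Fin k)
    (hj : c.2 j ≠ a j) : ofCoords x A a k c = Quot.mk _ (Sum.inr ⟨j, c.2 j⟩) := by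
  have h : ∃ j : Fin k, c.2 j ≠ a j := ⟨j, hj⟩
  have : h.choose = j := by
    by_contra hne
    exact h.choose_spec ((hc j hj).2 _ fun he => hne (Fin.ext he))
  rw [ofCoords, dif_pos h, this]

theorem ofCoords_of_forall_eq {k : ℕ} {c : X × ∀ j, A j} (h : ∀ j : Fin k, c.2 j = a j) :
    ofCoords x A a k c = Quot.mk _ (Sum.inl c.1) := by
  rw [ofCoords, dif_neg]
  simpa using h

theorem collapse_ofCoords (k : ℕ) {c : X × ∀ j, A j} (hc : c ∈ AdjCoords x A a) :
    collapse x A a k (ofCoords x A a (k + 1) c) = ofCoords x A a k c := by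
  by_cases h : ∃ j : Fin (k + 1), c.2 j ≠ a j
  · obtain ⟨j, hj⟩ := h
    rw [ofCoords_of_ne hc j hj]
    by_cases hk : (j : ℕ) < k
    · rw [ofCoords_of_ne hc ⟨j, hk⟩ hj]
      simp [collapse, hk]
    · rw [ofCoords_of_forall_eq fun i => (hc j hj).2 i (by omega), (hc j hj).1]
      simp [collapse, hk]
  · push Not at h
    rw [ofCoords_of_forall_eq h, ofCoords_of_forall_eq fun j : Fin k => h j.castSucc]
    rfl

/-- A nontrivial coordinate stays nontrivial nearby because `A j` is T1. The delicate points have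
all first `k` coordinates trivial: nearby tuples may lie in any of the pieces attached there. -/
theorem continuous_ofCoords [TopologicalSpace X] [T1Space X] [∀ j, TopologicalSpace (A j)]
    [∀ j, T1Space (A j)] (k : ℕ) :
    Continuous fun c : AdjCoords x A a => ofCoords x A a k c.1 := by
  have hQ : ∀ j, Continuous fun c : AdjCoords x A a => c.1.2 j := fun j => by fun_prop
  have hP : Continuous fun c : AdjCoords x A a => c.1.1 := by fun_prop
  have hinl : Continuous fun p : X => (Quot.mk _ (Sum.inl p) : FiniteAdj x A a k) :=
    continuous_quot_mk.comp continuous_inl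
  have hinr : ∀ j : Fin k, Continuous fun p : A j =>
      (Quot.mk _ (Sum.inr ⟨j, p⟩) : FiniteAdj x A a k) := fun j =>
    continuous_quot_mk.comp (continuous_inr.comp continuous_sigmaMk)
  rw [continuous_iff_continuousAt]
  intro c
  by_cases h : ∃ j : Fin k, c.1.2 j ≠ a j
  · obtain ⟨j, hj⟩ := h
    refine ContinuousAt.congr (((hinr j).comp (hQ j)).continuousAt) ?_
    filter_upwards [(hQ j).continuousAt.eventually_ne hj] with d hd
    exact (ofCoords_of_ne d.2 j hd).symm
  · push Not at h
    intro W hW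
    dsimp only at hW
    rw [ofCoords_of_forall_eq h] at hW
    have h1 : ∀ᶠ d : AdjCoords x A a in 𝓝 c, Quot.mk _ (Sum.inl d.1.1) ∈ W :=
      (hinl.comp hP).continuousAt hW
    -- A nearby tuple can enter the piece `A j` only over `x j`. If `c` lies over `x j`, the gluing
    -- relation makes the two descriptions of the limit agree; otherwise T1 keeps the core
    -- coordinate away from `x j`.
    have h2 : ∀ᶠ d : AdjCoords x A a in 𝓝 c, ∀ j : Fin k, d.1.1 = x j →
        Quot.mk _ (Sum.inr ⟨j, d.1.2 j⟩) ∈ W := by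
      rw [eventually_all]
      intro j
      by_cases hx : c.1.1 = x j
      · have : (Quot.mk _ (Sum.inr ⟨j, c.1.2 j⟩) : FiniteAdj x A a k) =
            Quot.mk _ (Sum.inl c.1.1) := by
          rw [h j, hx]; exact (Quot.sound (AdjRel.glue j)).symm
        rw [← this] at hW
        filter_upwards [((hinr j).comp (hQ j)).continuousAt hW] with d hd _ using hd
      · filter_upwards [hP.continuousAt.eventually_ne hx] with d hd he using absurd he hd
    rw [mem_map]
    filter_upwards [h1, h2] with d hd1 hd2
    by_cases hd : ∃ j : Fin k, d.1.2 j ≠ a j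
    · obtain ⟨j, hj⟩ := hd
      rw [Set.mem_preimage, ofCoords_of_ne d.2 j hj]
      exact hd2 j (d.2 j hj).1
    · push Not at hd
      rw [Set.mem_preimage, ofCoords_of_forall_eq hd]
      exact hd1

end FiniteAdj

namespace ShrinkingAdj

variable {X : Type*} (x : ℕ → X) (A : ℕ → Type*) (a : ∀ j, A j)

/-- The retraction onto the attached space `A j`, collapsing everything else to `a j`. -/
def coord (j : ℕ) (y : ShrinkingAdj x A a) : A j := FiniteAdj.coord x A a (j + 1) j (y.1 (j + 1))

theorem coord_eq (y : ShrinkingAdj x A a) {j k : ℕ} (h : j < k) :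
    FiniteAdj.coord x A a k j (y.1 k) = coord x A a j y := by
  induction k, h using Nat.le_induction with
  | base => rfl
  | succ k hk ih => rw [← ih, ← y.2 k, FiniteAdj.coord_collapse x A a k j hk]

variable [TopologicalSpace X] [∀ j, TopologicalSpace (A j)]

theorem continuous_coord (j : ℕ) : Continuous (coord x A a j) :=
  (FiniteAdj.continuous_coord x A a (j + 1) j).comp
    ((continuous_apply (j + 1)).comp continuous_subtype_val)

theorem coords_mem (y : ShrinkingAdj x A a) :
    (retraction x A a y, fun j => coord x A a j y) ∈ AdjCoords x A a := by
  intro j hj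
  have key : ∀ k, j < k → retraction x A a y = x j ∧
      ∀ i, i < k → i ≠ j → coord x A a i y = a i := by
    intro k hk
    have h1 := toCore_eq x A a y k
    change _ = retraction x A a y at h1
    have h2 := fun i (hi : i < k) => coord_eq x A a y hi
    rw [← h1]
    dsimp only at hj
    rw [← h2 j hk] at hj
    have h3 : ∀ i, i < k → i ≠ j → FiniteAdj.coord x A a k i (y.1 k) = a i := by
      intro i hi hij
      revert hj
      obtain ⟨p | ⟨l, p⟩⟩ := y.1 k
      · intro hj; exact absurd rfl hj
      · by_cases hl : (l : ℕ) = j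
        · have : (l : ℕ) ≠ i := by omega
          intro _; simp [FiniteAdj.coord, this]
        · intro hj; exact absurd (by simp [FiniteAdj.coord, hl]) hj
    refine ⟨?_, fun i hi hij => (h2 i hi).symm.trans (h3 i hi hij)⟩
    revert hj
    obtain ⟨p | ⟨l, p⟩⟩ := y.1 k
    · intro hj; exact absurd rfl hj
    · by_cases hl : (l : ℕ) = j
      · intro _; subst hl; rfl
      · intro hj; exact absurd (by simp [FiniteAdj.coord, hl]) hj
  exact ⟨(key (j + 1) (by omega)).1,
    fun i hi => (key (max i j + 1) (by omega)).2 i (by omega) hi⟩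

/-- A shrinking adjunction space embeds into the product of the core and the attached spaces. -/
def coordsHomeomorph [T1Space X] [∀ j, T1Space (A j)] :
    ShrinkingAdj x A a ≃ₜ AdjCoords x A a where
  toFun y := ⟨(retraction x A a y, fun j => coord x A a j y), coords_mem x A a y⟩
  invFun c := ⟨fun k => FiniteAdj.ofCoords x A a k c.1,
    fun k => FiniteAdj.collapse_ofCoords k c.2⟩
  left_inv y := by
    refine Subtype.ext (funext fun k => ?_)
    have hc := coords_mem x A a y
    by_cases h : ∃ j : Fin k, coord x A a j y ≠ a j
    · obtain ⟨j, hj⟩ := h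
      refine (FiniteAdj.ofCoords_of_ne hc j hj).trans ?_
      dsimp only
      rw [← coord_eq x A a y j.2] at hj ⊢
      revert hj
      obtain ⟨p | ⟨l, p⟩⟩ := y.1 k
      · intro hj; exact absurd rfl hj
      · by_cases hl : l = j
        · subst hl; intro _; simp [FiniteAdj.coord]
        · intro hj
          exact absurd (by simp [FiniteAdj.coord, Fin.val_ne_of_ne hl]) hj
    · push Not at h
      refine (FiniteAdj.ofCoords_of_forall_eq h).trans ?_
      dsimp only
      have h1 := toCore_eq x A a y k
      change _ = retraction x A a y at h1
      have h2 : ∀ j : Fin k, FiniteAdj.coord x A a k j (y.1 k) = a j :=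
        fun j => (coord_eq x A a y j.2).trans (h j)
      rw [← h1]
      revert h2
      obtain ⟨p | ⟨l, p⟩⟩ := y.1 k
      · intro _; rfl
      · intro h2
        have : p = a l := by simpa [FiniteAdj.coord] using h2 l
        subst this
        exact Quot.sound (AdjRel.glue l)
  right_inv c := by
    obtain ⟨c, hc⟩ := c
    refine Subtype.ext (Prod.ext ?_ (funext fun j => ?_))
    · change FiniteAdj.toCore x A a 0 (FiniteAdj.ofCoords x A a 0 c) = c.1
      rw [FiniteAdj.ofCoords_of_forall_eq fun j => j.elim0]
      rfl
    · change FiniteAdj.coord x A a (j + 1) j (FiniteAdj.ofCoords x A a (j + 1) c) = c.2 j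
      by_cases h : ∃ i : Fin (j + 1), c.2 i ≠ a i
      · obtain ⟨i, hi⟩ := h
        rw [FiniteAdj.ofCoords_of_ne hc i hi]
        by_cases hij : (i : ℕ) = j
        · obtain ⟨i, hi'⟩ := i
          dsimp only at hij
          subst hij
          simp [FiniteAdj.coord]
        · simp [FiniteAdj.coord, hij, (hc i hi).2 j (Ne.symm hij)]
      · push Not at h
        rw [FiniteAdj.ofCoords_of_forall_eq h]
        exact (h (Fin.last j)).symm
  continuous_toFun := Continuous.subtype_mk
    ((retraction x A a).continuous.prodMk (continuous_pi (continuous_coord x A a))) _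
  continuous_invFun := Continuous.subtype_mk
    (continuous_pi fun k => FiniteAdj.continuous_ofCoords k) _

end ShrinkingAdj

/-! ### Maps out of shrinking wedges -/

namespace ShrinkingWedge

section

variable (A : ℕ → Type*) (a : ∀ j, A j)

theorem incl_basepoint (j : ℕ) : incl A a j (a j) = base A a :=
  Quot.sound (WedgeRel.glue j 0)

variable [∀ j, TopologicalSpace (A j)]

theorem continuous_incl (j : ℕ) : Continuous (incl A a j) :=
  ⟨fun _ hU => hU.1 j⟩

variable {A a}

theorem eventually_forall_of_eventually_nhds_base {p : ShrinkingWedge A a → Prop}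
    (h : ∀ᶠ q in 𝓝 (base A a), p q) : ∀ᶠ j in atTop, ∀ t, p (incl A a j t) := by
  obtain ⟨U, hU, hUo, hb⟩ := eventually_nhds_iff.1 h
  rw [← Nat.cofinite_eq_atTop]
  refine (hUo.2 hb).subset fun j hj hsub => hj fun t => hU _ (hsub ⟨t, rfl⟩)

end

variable {S : Type*} [TopologicalSpace S] {s : S} {Z : Type*} [TopologicalSpace Z] {z : Z}

/-- The map out of a shrinking wedge of copies of `S` defined by a sequence of based maps
converging to the base point. -/
def lift (g : ℕ → C(S, Z)) (hs : ∀ m, g m s = z) (hg : ConvergesToPoint g z) :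
    C(ShrinkingWedge (fun _ : ℕ => S) (fun _ => s), Z) where
  toFun := Quot.lift (fun q => g q.1 q.2) (by rintro _ _ ⟨i, j⟩; exact (hs i).trans (hs j).symm)
  continuous_toFun := by
    refine ⟨fun U hU => ⟨fun j => hU.preimage (g j).continuous, fun hb => ?_⟩⟩
    have hz : z ∈ U := by
      rw [← hs 0]; exact hb
    have := hg U (hU.mem_nhds hz)
    rw [← Nat.cofinite_eq_atTop] at this
    refine this.subset fun j hj hsub => hj ?_
    rintro _ ⟨t, rfl⟩
    exact hsub ⟨t, rfl⟩

theorem convergesToPoint_comp_incl (F : C(ShrinkingWedge (fun _ : ℕ => S) (fun _ => s), Z))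
    (hF : F (base _ _) = z) :
    ConvergesToPoint (fun m => F.comp ⟨_, continuous_incl (fun _ : ℕ => S) (fun _ => s) m⟩) z := by
  intro U hU
  rw [← hF] at hU
  filter_upwards [eventually_forall_of_eventually_nhds_base (F.continuous.continuousAt hU)]
    with m hm
  rintro _ ⟨t, rfl⟩
  exact hm t

/-- A sequence of based homotopies converging to the base point defines a homotopy on the shrinking
wedge. -/
theorem exists_homotopy_lift (h : ℕ → C(I × S, Z)) (hs : ∀ m t, h m (t, s) = z)
    (hh : ConvergesToPoint h z) :
    ∃ H : C(I × ShrinkingWedge (fun _ : ℕ => S) (fun _ => s), Z),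
      ∀ m t p, H (t, incl _ _ m p) = h m (t, p) := by
  -- Currying turns a homotopy into a map to the path space, so `lift` applies and no description of
  -- the topology of `I × ShrinkingWedge` is needed.
  let c : ℕ → C(S, C(I, Z)) := fun m => ((h m).comp ContinuousMap.prodSwap).curry
  have hc : ConvergesToPoint c (ContinuousMap.const I z) := by
    rw [convergesToPoint_iff_tendsto, ContinuousMap.tendsto_nhds_compactOpen]
    intro K _ U hU hKU
    rcases K.eq_empty_or_nonempty with rfl | ⟨t, ht⟩
    · exact Eventually.of_forall fun _ _ h => h.elim
    · change _ ∈ _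
      rw [mem_prod_top]
      filter_upwards [hh U (hU.mem_nhds (hKU ht))] with m hm p t _ using hm ⟨(t, p), rfl⟩
  let L := lift (s := s) c (fun m => by ext t; exact hs m t) hc
  exact ⟨L.uncurry.comp ContinuousMap.prodSwap, fun m t p => rfl⟩

end ShrinkingWedge

/-! ### Filling spheres in sequentially connected spaces -/

theorem SequentiallyConnectedAt.mono {n k : ℕ} {A : Type*} [TopologicalSpace A] {a : A}
    (h : SequentiallyConnectedAt n A a) (hk : k ≤ n) : SequentiallyConnectedAt k A a :=
  fun l hl => h l (hl.trans hk)

/-- The sequence assembles to one based map of the earring, and a based contraction of that map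
restricts to the individual spheres. -/
theorem SequentiallyConnectedAt.exists_nullhomotopy {n k : ℕ} {A : Type*} [TopologicalSpace A]
    {a : A} (h : SequentiallyConnectedAt n A a) (hk : k ≤ n) (g : ℕ → C(UnitSphere k, A))
    (hb : ∀ m, g m (UnitSphere.base k) = a) (hg : ConvergesToPoint g a) :
    ∃ H : ℕ → C(I × UnitSphere k, A), (∀ m p, H m (0, p) = g m p) ∧ (∀ m p, H m (1, p) = a) ∧
      ConvergesToPoint H a := by
  have : Subsingleton (Quotient (basedHomotopySetoid _ (HawaiianEarring.base k) A a)) := h k hk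
  let F := ShrinkingWedge.lift g hb hg
  have hF : F (HawaiianEarring.base k) = a := hb 0
  have heq := Subsingleton.elim
    (Quotient.mk (basedHomotopySetoid _ _ _ _) (⟨F, hF⟩ : BasedMap _ (HawaiianEarring.base k) _ _))
    (Quotient.mk (basedHomotopySetoid _ _ _ _) ⟨ContinuousMap.const _ a, rfl⟩)
  obtain ⟨K⟩ := Quotient.exact heq
  have hK0 : ∀ q, K (0, q) = F q := K.map_zero_left
  have hK1 : ∀ q, K (1, q) = a := K.map_one_left
  have hKb : ∀ t, K (t, HawaiianEarring.base k) = a := fun t => (K.eq_fst t rfl).trans hF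
  refine ⟨fun m => (K.toContinuousMap : C(I × HawaiianEarring k, A)).comp
    ((ContinuousMap.id I).prodMap ⟨_, ShrinkingWedge.continuous_incl (fun _ => UnitSphere k) _ m⟩),
    fun m p => hK0 _, fun m p => hK1 _, fun U hU => ?_⟩
  -- Tube lemma: the homotopy is constant at the wedge point and `I` is compact, so a whole
  -- neighbourhood of that point, hence almost every sphere, stays in `U`.
  have hev : ∀ᶠ q in 𝓝 (HawaiianEarring.base k), ∀ t ∈ (Set.univ : Set I), K (t, q) ∈ U := by
    refine isCompact_univ.eventually_forall_of_forall_eventually fun t _ => ?_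
    have hc : Continuous fun w : HawaiianEarring k × I => K (w.2, w.1) :=
      K.continuous.comp continuous_swap
    refine hc.continuousAt (x := (HawaiianEarring.base k, t)) ?_
    dsimp only
    rw [hKb]
    exact hU
  filter_upwards [ShrinkingWedge.eventually_forall_of_eventually_nhds_base hev] with m hm
  rintro _ ⟨⟨t, p⟩, rfl⟩
  exact hm p t trivial

theorem SequentiallyConnectedAt.exists_nullhomotopy_of_countable {n k : ℕ} {A : Type*}
    [TopologicalSpace A] {a : A} (h : SequentiallyConnectedAt n A a) (hk : k ≤ n) {ι : Type*}
    [Countable ι] (g : ι → C(UnitSphere k, A)) (hb : ∀ i, g i (UnitSphere.base k) = a)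
    (hg : ∀ U ∈ 𝓝 a, ∀ᶠ i in cofinite, ∀ p, g i p ∈ U) :
    ∃ H : ι → C(I × UnitSphere k, A), (∀ i p, H i (0, p) = g i p) ∧ (∀ i p, H i (1, p) = a) ∧
      ∀ U ∈ 𝓝 a, ∀ᶠ i in cofinite, ∀ w, H i w ∈ U := by
  obtain ⟨e, he⟩ := exists_injective_nat ι
  obtain ⟨H, h0, h1, h2⟩ := h.exists_nullhomotopy hk
    -- Indices outside the image of `e` receive the constant map, which also covers finite and empty
    -- `ι`.
    (Function.extend e g fun _ => ContinuousMap.const _ a)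
    (fun m => by
      by_cases hm : ∃ i, e i = m
      · obtain ⟨i, rfl⟩ := hm
        rw [he.extend_apply]; exact hb i
      · rw [Function.extend_apply' _ _ _ hm]; rfl)
    (fun U hU => by
      rw [← Nat.cofinite_eq_atTop]
      refine ((hg U hU).image e).subset fun m hm => ?_
      by_cases hi : ∃ i, e i = m
      · obtain ⟨i, rfl⟩ := hi
        refine ⟨i, fun hi => hm ?_, rfl⟩
        rw [Set.mem_ofPred_eq, he.extend_apply]
        rintro _ ⟨p, rfl⟩
        exact hi p
      · refine absurd ?_ hm
        rw [Set.mem_ofPred_eq, Function.extend_apply' _ _ _ hi]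
        rintro _ ⟨p, rfl⟩
        exact mem_of_mem_nhds hU)
  refine ⟨fun i => H (e i), fun i p => by rw [h0, he.extend_apply], fun i p => h1 _ p,
    fun U hU => ?_⟩
  have := h2 U hU
  rw [← Nat.cofinite_eq_atTop] at this
  filter_upwards [he.tendsto_cofinite.eventually this] with i hi w using hi ⟨w, rfl⟩

/-! ### Radial coordinates and the filling of cylinders -/

/-- The cylinder over `ℝ^J` as a Euclidean space, with the cylinder axis as first coordinate. -/
def cylinderEquivEuclidean (J : Type*) [Fintype J] {k : ℕ} (hJ : Fintype.card J = k) :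
    (ℝ × (J → ℝ)) ≃L[ℝ] EuclideanSpace ℝ (Fin (k + 1)) :=
  (((ContinuousLinearEquiv.refl ℝ ℝ).prodCongr
    (LinearEquiv.funCongrLeft ℝ ℝ (Fintype.equivFinOfCardEq hJ).symm).toContinuousLinearEquiv).trans
    (Fin.consEquivL ℝ fun _ : Fin (k + 1) => ℝ)).trans
    (EuclideanSpace.equiv (Fin (k + 1)) ℝ).symm

/-- The sphere's base point must correspond to the centre of the top face of the cylinder, where the
maps to be extended take the value `a`. -/
theorem cylinderEquivEuclidean_axis (J : Type*) [Fintype J] {k : ℕ} (hJ : Fintype.card J = k) :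
    cylinderEquivEuclidean J hJ (1, 0) = EuclideanSpace.single 0 1 := by
  ext i
  refine Fin.cases ?_ (fun i => ?_) i <;> simp [cylinderEquivEuclidean]

/-- The radial projection of a normed space onto the unit sphere along a linear equivalence. -/
def radialProj {W : Type*} [NormedAddCommGroup W] [NormedSpace ℝ W] {k : ℕ}
    (L : W ≃L[ℝ] EuclideanSpace ℝ (Fin (k + 1))) (w : W) : UnitSphere k :=
  open Classical in
  -- The value at the origin is arbitrary: it is only fed into a homotopy that has become constant
  -- there.
  if h : w = 0 then UnitSphere.base k
  else ⟨‖L w‖⁻¹ • L w, by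
    have : L w ≠ 0 := by simpa using h
    simp [norm_smul, this]⟩

section radialProj

variable {W : Type*} [NormedAddCommGroup W] [NormedSpace ℝ W] {k : ℕ}
    (L : W ≃L[ℝ] EuclideanSpace ℝ (Fin (k + 1)))

theorem coe_radialProj {w : W} (h : w ≠ 0) : (radialProj L w : EuclideanSpace ℝ _) =
    ‖L w‖⁻¹ • L w := by
  simp [radialProj, h]

theorem continuousAt_radialProj {w : W} (h : w ≠ 0) : ContinuousAt (radialProj L) w := by
  rw [Topology.IsInducing.subtypeVal.continuousAt_iff]
  have h1 : ContinuousAt (fun w => ‖L w‖⁻¹ • L w) w := by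
    have : ‖L w‖ ≠ 0 := by simpa using h
    fun_prop (disch := assumption)
  refine h1.congr ?_
  filter_upwards [isOpen_ne.mem_nhds h] with v hv
  exact (coe_radialProj L hv).symm

/-- The inverse of the radial projection on the unit sphere of `W`. -/
def radialSection (p : UnitSphere k) : W := ‖L.symm (p : EuclideanSpace ℝ _)‖⁻¹ • L.symm p

theorem continuous_radialSection : Continuous (radialSection L) := by
  have : ∀ p : UnitSphere k, ‖L.symm (p : EuclideanSpace ℝ (Fin (k + 1)))‖ ≠ 0 := fun p => by
    simpa using ne_zero_of_mem_unit_sphere p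
  unfold radialSection
  fun_prop (disch := assumption)

theorem norm_radialSection (p : UnitSphere k) : ‖radialSection L p‖ = 1 := by
  have : L.symm (p : EuclideanSpace ℝ (Fin (k + 1))) ≠ 0 := by
    simpa using ne_zero_of_mem_unit_sphere p
  simp [radialSection, norm_smul, this]

theorem radialSection_radialProj {w : W} (h : ‖w‖ = 1) :
    radialSection L (radialProj L w) = w := by
  have h0 : w ≠ 0 := by rintro rfl; simp at h
  have h1 : ‖L w‖ ≠ 0 := by simpa using h0
  simp [radialSection, coe_radialProj L h0, norm_smul, smul_smul, h, h1]

end radialProj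

/-- Maps of unit spheres of cylinders `ℝ × ℝ^J` that converge to `a` extend over the cylinders, with
extensions converging to `a`. -/
theorem SequentiallyConnectedAt.exists_extension {n k : ℕ} {A : Type*} [TopologicalSpace A]
    {a : A} (h : SequentiallyConnectedAt n A a) (hk : k ≤ n) {ι : Type*} [Countable ι]
    {J : ι → Type*} [∀ i, Fintype (J i)] (hJ : ∀ i, Fintype.card (J i) = k)
    (φ : ∀ i, ℝ × (J i → ℝ) → A) (hc : ∀ i, ContinuousOn (φ i) (Metric.sphere 0 1))
    (ha : ∀ i, φ i (1, 0) = a)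
    (hφ : ∀ U ∈ 𝓝 a, ∀ᶠ i in cofinite, ∀ w ∈ Metric.sphere 0 1, φ i w ∈ U) :
    ∃ Φ : ∀ i, ℝ × (J i → ℝ) → A, (∀ i, Continuous (Φ i)) ∧
      (∀ i, ∀ w ∈ Metric.sphere 0 1, Φ i w = φ i w) ∧
      ∀ U ∈ 𝓝 a, ∀ᶠ i in cofinite, ∀ w, Φ i w ∈ U := by
  let L := fun i => cylinderEquivEuclidean (J i) (hJ i)
  have hsec : ∀ i p, radialSection (L i) p ∈ Metric.sphere (0 : ℝ × (J i → ℝ)) 1 := fun i p => by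
    simpa using norm_radialSection (L i) p
  obtain ⟨H, H0, H1, Hc⟩ := h.exists_nullhomotopy_of_countable hk
    (fun i => ⟨fun p => φ i (radialSection (L i) p),
      (hc i).comp_continuous (continuous_radialSection (L i)) (hsec i)⟩)
    (fun i => by
      have h1 : (UnitSphere.base k).1 = L i (1, 0) := (cylinderEquivEuclidean_axis (J i) (hJ i)).symm
      have h2 : radialSection (L i) (UnitSphere.base k) = (1, 0) := by
        simp [radialSection, h1, Prod.norm_def]
      simp only [ContinuousMap.coe_mk, h2, ha])
    (fun U hU => by
      filter_upwards [hφ U hU] with i hi p using hi _ (hsec i p))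
  -- Time runs from 0 on the unit sphere to 1 at the origin. Clamping outside the ball keeps all
  -- values of `Φ i` among those of `H i`.
  let τ : ∀ i, ℝ × (J i → ℝ) → I := fun i w => Set.projIcc 0 1 zero_le_one (1 - ‖w‖)
  have hτ : ∀ i, Continuous (τ i) := fun i => by fun_prop
  refine ⟨fun i w => H i (τ i w, radialProj (L i) w), fun i => ?_, fun i w hw => ?_,
    fun U hU => ?_⟩
  · rw [continuous_iff_continuousAt]
    intro w
    by_cases hw : w = 0
    · subst hw
      have hτ0 : τ i 0 = 1 := by simp [τ]
      intro U hU
      simp only [hτ0, H1] at hU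
      -- `radialProj` is discontinuous at the origin, so closeness to `a` is needed uniformly in the
      -- direction; compactness of the sphere supplies it.
      have hev : ∀ᶠ t in 𝓝 (1 : I), ∀ p ∈ (Set.univ : Set (UnitSphere k)), H i (t, p) ∈ U := by
        refine isCompact_univ.eventually_forall_of_forall_eventually fun p _ => ?_
        refine (H i).continuous.continuousAt (x := (1, p)) ?_
        rw [H1]
        exact hU
      rw [← hτ0] at hev
      rw [mem_map]
      filter_upwards [(hτ i).continuousAt.eventually hev] with w hw using hw _ trivial
    · exact (H i).continuous.continuousAt.comp
        ((hτ i).continuousAt.prodMk (continuousAt_radialProj (L i) hw))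
  · have hw' : ‖w‖ = 1 := by simpa using hw
    have h0 : τ i w = 0 := by simp [τ, hw']
    simp only [h0, H0, ContinuousMap.coe_mk, radialSection_radialProj (L i) hw']
  · filter_upwards [Hc U hU] with i hi w using hi _

/-! ### Dyadic faces -/

/-- A dyadic face in the `sheet`-th copy of `ℝⁿ`: the product of the intervals
`[lo i / 2 ^ level, hi i / 2 ^ level]`. -/
structure DyadicFace (n : ℕ) where
  sheet : ℕ
  level : ℕ
  lo : Fin n → ℤ
  hi : Fin n → ℤ

namespace DyadicFace

variable {n : ℕ}

instance : Countable (DyadicFace n) := by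
  let f : DyadicFace n → ℕ × ℕ × (Fin n → ℤ) × (Fin n → ℤ) :=
    fun F => (F.sheet, F.level, F.lo, F.hi)
  refine Function.Injective.countable (f := f) ?_
  rintro ⟨⟩ ⟨⟩ h
  simpa [f] using h

/-- The closed face. -/
def carrier (F : DyadicFace n) : Set (ℕ × (Fin n → ℝ)) :=
  {z | z.1 = F.sheet ∧ ∀ i, F.lo i ≤ 2 ^ F.level * z.2 i ∧ 2 ^ F.level * z.2 i ≤ F.hi i}

/-- The union of the closed cubes of the same level that contain the face. -/
def star (F : DyadicFace n) : Set (ℕ × (Fin n → ℝ)) :=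
  {z | z.1 = F.sheet ∧
    ∀ i, (F.hi i : ℝ) - 1 ≤ 2 ^ F.level * z.2 i ∧ 2 ^ F.level * z.2 i ≤ F.lo i + 1}

/-- The directions in which the face is nondegenerate. -/
abbrev Free (F : DyadicFace n) : Type := {i // F.lo i ≠ F.hi i}

/-- The dimension of a face. -/
def dim (F : DyadicFace n) : ℕ := Fintype.card F.Free

theorem dim_le (F : DyadicFace n) : F.dim ≤ n := by
  exact (Fintype.card_subtype_le fun i => F.lo i ≠ F.hi i).trans_eq (Fintype.card_fin n)

/-- Coordinates on a face taking values in `[-1, 1]`. -/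
def coords (F : DyadicFace n) (z : ℕ × (Fin n → ℝ)) : F.Free → ℝ :=
  fun i => 2 * (2 ^ F.level * z.2 i) - F.lo i - F.hi i

/-- The affine parametrization of a face. -/
def param (F : DyadicFace n) (w : F.Free → ℝ) : ℕ × (Fin n → ℝ) :=
  (F.sheet, fun i => (2 ^ F.level)⁻¹ *
    (if h : F.lo i ≠ F.hi i then ((F.lo i : ℝ) + F.hi i + w ⟨i, h⟩) / 2 else F.lo i))

theorem continuous_coords (F : DyadicFace n) : Continuous F.coords := by
  unfold coords; fun_prop

theorem continuous_param (F : DyadicFace n) : Continuous F.param := by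
  refine continuous_const.prodMk (continuous_pi fun i => ?_)
  by_cases h : F.lo i = F.hi i
  · simpa [h] using continuous_const
  · simp only [ne_eq, h, not_false_eq_true, dite_true]; fun_prop

theorem isClosed_carrier (F : DyadicFace n) : IsClosed F.carrier := by
  unfold carrier
  simp only [Set.ofPred_and, Set.ofPred_forall]
  refine (isClosed_eq continuous_fst continuous_const).inter (isClosed_iInter fun i => ?_)
  exact (isClosed_le (by fun_prop) (by fun_prop)).inter (isClosed_le (by fun_prop) (by fun_prop))

/-- The dyadic face of level `l` whose relative interior contains `z`. -/
def containing (l : ℕ) (z : ℕ × (Fin n → ℝ)) : DyadicFace n :=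
  ⟨z.1, l, fun i => ⌊2 ^ l * z.2 i⌋, fun i => ⌈2 ^ l * z.2 i⌉⟩

theorem mem_carrier_containing (l : ℕ) (z : ℕ × (Fin n → ℝ)) : z ∈ (containing l z).carrier :=
  ⟨rfl, fun _ => ⟨Int.floor_le _, Int.le_ceil _⟩⟩

/-- A face of one of the cubes of its level. -/
def IsCubical (F : DyadicFace n) : Prop := ∀ i, F.lo i = F.hi i ∨ F.hi i = F.lo i + 1

theorem isCubical_containing (l : ℕ) (z : ℕ × (Fin n → ℝ)) : (containing l z).IsCubical := by
  intro i
  simp only [containing]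
  have h1 := Int.floor_le_ceil (2 ^ l * z.2 i)
  have h2 := Int.ceil_le_floor_add_one (2 ^ l * z.2 i)
  omega

theorem IsCubical.hi_of_free {F : DyadicFace n} (hF : F.IsCubical) (i : F.Free) :
    (F.hi i : ℝ) = F.lo i + 1 := by
  rcases hF i with h | h
  · exact absurd h i.2
  · rw [h]; push_cast; rfl

theorem IsCubical.carrier_subset_star {F : DyadicFace n} (hF : F.IsCubical) :
    F.carrier ⊆ F.star := by
  rintro z ⟨hz, h⟩
  refine ⟨hz, fun i => ?_⟩
  obtain ⟨h1, h2⟩ := h i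
  rcases hF i with h | h
  · rw [h] at h1 ⊢; constructor <;> linarith
  · rw [h] at h2 ⊢; push_cast at h2 ⊢; constructor <;> linarith

theorem IsCubical.norm_coords_le {F : DyadicFace n} (hF : F.IsCubical) {z : ℕ × (Fin n → ℝ)}
    (hz : z ∈ F.carrier) : ‖F.coords z‖ ≤ 1 := by
  rw [pi_norm_le_iff_of_nonneg zero_le_one]
  intro i
  have h1 := hF.hi_of_free i
  obtain ⟨h2, h3⟩ := hz.2 i
  rw [Real.norm_eq_abs, abs_le, coords]
  constructor <;> linarith

theorem param_coords {F : DyadicFace n} {z : ℕ × (Fin n → ℝ)}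
    (hz : z ∈ F.carrier) : F.param (F.coords z) = z := by
  refine Prod.ext hz.1.symm (funext fun i => ?_)
  have h2 : (2 : ℝ) ^ F.level ≠ 0 := by positivity
  simp only [param, coords]
  split_ifs with h
  · field_simp; ring
  · push Not at h
    obtain ⟨h3, h4⟩ := hz.2 i
    rw [← h] at h4
    rw [le_antisymm h3 h4]
    field_simp

theorem coords_param (F : DyadicFace n) (w : F.Free → ℝ) : F.coords (F.param w) = w := by
  ext i
  have h2 : (2 : ℝ) ^ F.level ≠ 0 := by positivity
  simp only [param, coords, i.2, ne_eq, not_false_eq_true, dite_true]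
  field_simp; ring

theorem IsCubical.param_mem {F : DyadicFace n} (hF : F.IsCubical) {w : F.Free → ℝ}
    (hw : ‖w‖ ≤ 1) : F.param w ∈ F.carrier := by
  refine ⟨rfl, fun i => ?_⟩
  have h2 : (2 : ℝ) ^ F.level ≠ 0 := by positivity
  simp only [param, mul_inv_cancel_left₀ h2]
  split_ifs with h
  · have h1 := hF.hi_of_free ⟨i, h⟩
    have h3 := (norm_le_pi_norm w ⟨i, h⟩).trans hw
    rw [Real.norm_eq_abs, abs_le] at h3
    dsimp only at h1
    constructor <;> linarith
  · push Not at h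
    rw [h]; exact ⟨le_rfl, le_rfl⟩

/-- In the sup norm, norm 1 singles out the relative boundary of a face. A vertex has no free
directions, so its coordinates have norm 0 and its boundary is empty. -/
theorem IsCubical.exists_eq_of_norm_coords_eq_one {F : DyadicFace n} (hF : F.IsCubical)
    {z : ℕ × (Fin n → ℝ)} (h : ‖F.coords z‖ = 1) :
    ∃ i : F.Free, 2 ^ F.level * z.2 i = F.lo i ∨ 2 ^ F.level * z.2 i = F.hi i := by
  obtain ⟨i, hi⟩ : ∃ i, 1 ≤ ‖F.coords z i‖ := by
    by_contra! hlt
    exact h.not_lt ((pi_norm_lt_iff zero_lt_one).2 hlt)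
  have hi : ‖F.coords z i‖ = 1 := le_antisymm (h ▸ norm_le_pi_norm _ i) hi
  refine ⟨i, ?_⟩
  have h1 := hF.hi_of_free i
  rw [Real.norm_eq_abs, coords] at hi
  rcases abs_eq zero_le_one |>.1 hi with h | h
  · right; linarith
  · left; linarith

theorem IsCubical.norm_coords_eq_one {F : DyadicFace n} (hF : F.IsCubical)
    {z : ℕ × (Fin n → ℝ)} (hz : z ∈ F.carrier)
    (h : ∃ i : F.Free, 2 ^ F.level * z.2 i = F.lo i ∨ 2 ^ F.level * z.2 i = F.hi i) :
    ‖F.coords z‖ = 1 := by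
  refine le_antisymm (hF.norm_coords_le hz) ?_
  obtain ⟨i, hi⟩ := h
  refine le_trans ?_ (norm_le_pi_norm _ i)
  have h1 := hF.hi_of_free i
  rw [coords, Real.norm_eq_abs]
  rcases hi with h | h <;> rw [h, h1]
  · rw [le_abs]; right; linarith
  · rw [le_abs]; left; linarith

/-- A point in the relative interior of a face determines the face. -/
theorem containing_eq_of_norm_coords_ne {l : ℕ} {z z' : ℕ × (Fin n → ℝ)}
    (hz : z' ∈ (containing l z).carrier) (h : ‖(containing l z).coords z'‖ ≠ 1) :
    containing l z' = containing l z := by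
  set F := containing l z with hFdef
  have hF : F.IsCubical := isCubical_containing l z
  have h1 : ∀ i, ⌊2 ^ l * z'.2 i⌋ = F.lo i ∧ ⌈2 ^ l * z'.2 i⌉ = F.hi i := by
    intro i
    obtain ⟨h2, h3⟩ := hz.2 i
    change (F.lo i : ℝ) ≤ 2 ^ l * z'.2 i at h2
    change 2 ^ l * z'.2 i ≤ F.hi i at h3
    by_cases hi : F.lo i = F.hi i
    · rw [← hi] at h3 ⊢
      rw [← le_antisymm h2 h3]
      simp
    · have h4 := hF.hi_of_free ⟨i, hi⟩
      dsimp only at h4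
      have h5 : 2 ^ l * z'.2 i ≠ F.lo i := fun he =>
        h (hF.norm_coords_eq_one hz ⟨⟨i, hi⟩, Or.inl he⟩)
      have h6 : 2 ^ l * z'.2 i ≠ F.hi i := fun he =>
        h (hF.norm_coords_eq_one hz ⟨⟨i, hi⟩, Or.inr he⟩)
      have h7 := lt_of_le_of_ne h2 h5.symm
      have h8 := lt_of_le_of_ne h3 h6
      refine ⟨Int.floor_eq_iff.2 ⟨h2, by linarith⟩, Int.ceil_eq_iff.2 ⟨by linarith, h3⟩⟩
  have h2 : (containing l z').lo = F.lo := funext fun i => (h1 i).1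
  have h3 : (containing l z').hi = F.hi := funext fun i => (h1 i).2
  have h4 : z'.1 = F.sheet := hz.1
  have : containing l z' = ⟨z'.1, l, (containing l z').lo, (containing l z').hi⟩ := rfl
  rw [this, h2, h3, h4, hFdef]
  rfl

theorem two_pow_mul_eq {l m : ℕ} (h : l ≤ m) (t : ℝ) :
    (2 : ℝ) ^ m * t = ((2 ^ (m - l) : ℤ) : ℝ) * (2 ^ l * t) := by
  push_cast
  rw [← mul_assoc, ← pow_add, Nat.sub_add_cancel h]

/-- Finer faces through points of a face are contained in the face. -/
theorem carrier_containing_subset {F : DyadicFace n} {m : ℕ} (h : F.level ≤ m)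
    {z : ℕ × (Fin n → ℝ)} (hz : z ∈ F.carrier) : (containing m z).carrier ⊆ F.carrier := by
  rintro q ⟨hq, hqi⟩
  refine ⟨hq.trans hz.1, fun i => ?_⟩
  obtain ⟨h1, h2⟩ := hz.2 i
  obtain ⟨h3, h4⟩ := hqi i
  simp only [containing] at h3 h4
  have hpos : (0 : ℝ) < ((2 ^ (m - F.level) : ℤ) : ℝ) := by positivity
  constructor
  · have h5 : 2 ^ (m - F.level) * F.lo i ≤ ⌊(2 : ℝ) ^ m * z.2 i⌋ := by
      rw [Int.le_floor, two_pow_mul_eq h, Int.cast_mul]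
      exact mul_le_mul_of_nonneg_left h1 hpos.le
    have h6 := (Int.cast_le (R := ℝ).2 h5).trans h3
    rw [two_pow_mul_eq h, Int.cast_mul] at h6
    exact le_of_mul_le_mul_left h6 hpos
  · have h5 : ⌈(2 : ℝ) ^ m * z.2 i⌉ ≤ 2 ^ (m - F.level) * F.hi i := by
      rw [Int.ceil_le, two_pow_mul_eq h, Int.cast_mul]
      exact mul_le_mul_of_nonneg_left h2 hpos.le
    have h6 := h4.trans (Int.cast_le (R := ℝ).2 h5)
    rw [two_pow_mul_eq h, Int.cast_mul] at h6
    exact le_of_mul_le_mul_left h6 hpos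

/-- Finer faces through boundary points of a face have smaller dimension. -/
theorem dim_containing_lt {F : DyadicFace n} (hF : F.IsCubical) {m : ℕ}
    (h : F.level ≤ m) {z : ℕ × (Fin n → ℝ)} (hz : z ∈ F.carrier) (hb : ‖F.coords z‖ = 1) :
    (containing m z).dim < F.dim := by
  obtain ⟨i, hi⟩ := hF.exists_eq_of_norm_coords_eq_one hb
  -- A coordinate that is integral at the scale of `F` is integral at every finer scale. Hence the
  -- degenerate directions of `F` persist, and the boundary direction `i` becomes one more.
  have hint : ∀ j, (∃ c : ℤ, 2 ^ F.level * z.2 j = c) →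
      (containing m z).lo j = (containing m z).hi j := by
    rintro j ⟨c, hc⟩
    simp only [containing]
    rw [two_pow_mul_eq h, hc, ← Int.cast_mul, Int.floor_intCast, Int.ceil_intCast]
  have hdeg := hint i (by rcases hi with h | h <;> exact ⟨_, h⟩)
  refine Fintype.card_lt_of_injective_of_notMem
    (fun j : (containing m z).Free => (⟨j.1, fun hj => j.2 (hint _ ⟨F.lo j, ?_⟩)⟩ : F.Free))
    ?_ (b := i) ?_
  · obtain ⟨h1, h2⟩ := hz.2 j
    rw [← hj] at h2
    exact le_antisymm h2 h1
  · intro j j' hjj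
    exact Subtype.ext (congrArg (Subtype.val : F.Free → _) hjj)
  · rintro ⟨j, rfl⟩
    exact j.2 hdeg

/-- The face around `z'` is a face of the one around `z`, and a smaller face lies in more cubes. -/
theorem star_containing_subset {m : ℕ} {z z' : ℕ × (Fin n → ℝ)}
    (hz : z' ∈ (containing m z).carrier) : (containing m z).star ⊆ (containing m z').star := by
  rintro q ⟨hq, hqi⟩
  refine ⟨hq.trans hz.1.symm, fun i => ?_⟩
  obtain ⟨h1, h2⟩ := hqi i
  obtain ⟨h3, h4⟩ := hz.2 i
  simp only [containing] at h1 h2 h3 h4 ⊢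
  have h5 : ⌈(2 : ℝ) ^ m * z'.2 i⌉ ≤ ⌈(2 : ℝ) ^ m * z.2 i⌉ := Int.ceil_le.2 h4
  have h6 : ⌊(2 : ℝ) ^ m * z.2 i⌋ ≤ ⌊(2 : ℝ) ^ m * z'.2 i⌋ := Int.le_floor.2 h3
  have h7 := Int.cast_le (R := ℝ).2 h5
  have h8 := Int.cast_le (R := ℝ).2 h6
  constructor <;> linarith

/-- Points of the star of level `l` are at distance at most `2⁻ˡ`. -/
theorem dist_le_of_mem_star {l : ℕ} {z q : ℕ × (Fin n → ℝ)} (hq : q ∈ (containing l z).star) :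
    dist q z ≤ (2 ^ l : ℝ)⁻¹ := by
  have hpos : (0 : ℝ) < 2 ^ l := by positivity
  rw [Prod.dist_eq, max_le_iff]
  refine ⟨by rw [hq.1]; simp [containing], (dist_pi_le_iff (by positivity)).2 fun i => ?_⟩
  obtain ⟨h1, h2⟩ := hq.2 i
  obtain ⟨h3, h4⟩ := (mem_carrier_containing l z).2 i
  simp only [containing] at h1 h2 h3 h4
  rw [Real.dist_eq, inv_eq_one_div, le_div_iff₀ hpos]
  nth_rw 1 [← abs_of_pos hpos]
  rw [← abs_mul, abs_le]
  constructor <;> linarith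

end DyadicFace

/-! ### The dyadic cell decomposition of an open set -/

namespace DyadicFace

variable {n : ℕ} {U : Set (ℕ × (Fin n → ℝ))}

/-- The least level at which the star of the dyadic face around `z` is contained in `U`. -/
def cellLevel (U : Set (ℕ × (Fin n → ℝ))) (z : ℕ × (Fin n → ℝ)) : ℕ :=
  sInf {l | (containing l z).star ⊆ U}

/-- The cell of the dyadic decomposition of `U` whose relative interior contains `z`. -/
def cell (U : Set (ℕ × (Fin n → ℝ))) (z : ℕ × (Fin n → ℝ)) : DyadicFace n :=
  containing (cellLevel U z) z

theorem isCubical_cell (z : ℕ × (Fin n → ℝ)) : (cell U z).IsCubical := isCubical_containing _ z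

theorem mem_carrier_cell (z : ℕ × (Fin n → ℝ)) : z ∈ (cell U z).carrier :=
  mem_carrier_containing _ z

theorem star_subset_of_lt {l : ℕ} {z : ℕ × (Fin n → ℝ)} {δ : ℝ} (hδ : (2 ^ l : ℝ)⁻¹ < δ)
    (h : Metric.ball z δ ⊆ U) : (containing l z).star ⊆ U :=
  fun _ hq => h ((dist_le_of_mem_star hq).trans_lt hδ)

theorem exists_two_pow_inv_lt {δ : ℝ} (hδ : 0 < δ) : ∃ l : ℕ, (2 ^ l : ℝ)⁻¹ < δ := by
  obtain ⟨l, hl⟩ := exists_pow_lt_of_lt_one hδ (by norm_num : (2⁻¹ : ℝ) < 1)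
  exact ⟨l, by rwa [← inv_pow]⟩

theorem star_cell_subset (hU : IsOpen U) {z : ℕ × (Fin n → ℝ)} (hz : z ∈ U) :
    (cell U z).star ⊆ U := by
  obtain ⟨δ, hδ, h⟩ := Metric.isOpen_iff.1 hU z hz
  obtain ⟨l, hl⟩ := exists_two_pow_inv_lt hδ
  exact Nat.sInf_mem (s := {l | (containing l z).star ⊆ U}) ⟨l, star_subset_of_lt hl h⟩

theorem carrier_cell_subset (hU : IsOpen U) {z : ℕ × (Fin n → ℝ)} (hz : z ∈ U) :
    (cell U z).carrier ⊆ U :=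
  (isCubical_cell z).carrier_subset_star.trans (star_cell_subset hU hz)

/-- If a coarser level sufficed at `z'`, then, as stars grow on passing to a face, the same level
would suffice at `z`, against minimality. So the boundary of a cell is only ever subdivided, never
crossed by coarser cells. -/
theorem cellLevel_le_of_mem (hU : IsOpen U) {z z' : ℕ × (Fin n → ℝ)} (hz : z ∈ U)
    (hz' : z' ∈ (cell U z).carrier) : cellLevel U z ≤ cellLevel U z' := by
  by_contra! hlt
  have h1 : z ∈ (containing (cellLevel U z) z).carrier := mem_carrier_containing _ z
  have h2 : z' ∈ (containing (cellLevel U z') z).carrier := by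
    have h3 : (cell U z).carrier ⊆ (containing (cellLevel U z') z).carrier :=
      carrier_containing_subset (F := containing (cellLevel U z') z) hlt.le
        (mem_carrier_containing _ z)
    exact h3 hz'
  exact hlt.not_ge (Nat.sInf_le ((star_containing_subset h2).trans
    (star_cell_subset hU (carrier_cell_subset hU hz hz'))))

theorem cell_eq_of_norm_coords_ne (hU : IsOpen U) {z z' : ℕ × (Fin n → ℝ)} (hz : z ∈ U)
    (hz' : z' ∈ (cell U z).carrier) (h : ‖(cell U z).coords z'‖ ≠ 1) :
    cell U z' = cell U z := by
  have h1 : containing (cellLevel U z) z' = cell U z := containing_eq_of_norm_coords_ne hz' h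
  have h2 : cellLevel U z' = cellLevel U z := by
    refine le_antisymm (Nat.sInf_le ?_) (cellLevel_le_of_mem hU hz hz')
    rw [Set.mem_ofPred_eq, h1]
    exact star_cell_subset hU hz
  rw [← h1, cell, h2]

theorem dim_cell_lt (hU : IsOpen U) {z z' : ℕ × (Fin n → ℝ)} (hz : z ∈ U)
    (hz' : z' ∈ (cell U z).carrier) (h : ‖(cell U z).coords z'‖ = 1) :
    (cell U z').dim < (cell U z).dim :=
  dim_containing_lt (isCubical_cell z) (cellLevel_le_of_mem hU hz hz') hz' h

/-- The cells of the dyadic decomposition of `U`. -/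
def cells (U : Set (ℕ × (Fin n → ℝ))) : Set (DyadicFace n) := cell U '' U

theorem isCompact_carrier {F : DyadicFace n} (hF : F.IsCubical) : IsCompact F.carrier := by
  have : F.carrier = F.param '' Metric.closedBall 0 1 := by
    ext z
    constructor
    · intro hz
      exact ⟨F.coords z, by simpa using hF.norm_coords_le hz, param_coords hz⟩
    · rintro ⟨w, hw, rfl⟩
      exact hF.param_mem (by simpa using hw)
  rw [this]
  exact (isCompact_closedBall _ _).image F.continuous_param

/-- Compact subsets of `U` meet finitely many cells. -/
theorem finite_cells_inter (hU : IsOpen U) {K : Set (ℕ × (Fin n → ℝ))} (hK : IsCompact K)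
    (hKU : K ⊆ U) : {F ∈ cells U | (F.carrier ∩ K).Nonempty}.Finite := by
  obtain ⟨δ, hδ, hthick⟩ := hK.exists_thickening_subset_open hU hKU
  obtain ⟨L, hL⟩ := exists_two_pow_inv_lt hδ
  obtain ⟨R, hR⟩ := hK.isBounded.subset_closedBall 0
  -- The summand 1 allows for `lo` and `hi` lying up to one unit beyond the scaled coordinates of a
  -- point of the face.
  obtain ⟨B, hB⟩ := exists_nat_ge (2 ^ L * |R| + 1)
  have hfin : ((Set.Iic B ×ˢ Set.Iic L ×ˢ Set.Icc (fun _ => -(B : ℤ)) (fun _ => (B : ℤ)) ×ˢ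
      Set.Icc (fun _ => -(B : ℤ)) (fun _ => (B : ℤ)) :
      Set (ℕ × ℕ × (Fin n → ℤ) × (Fin n → ℤ)))).Finite :=
    (Set.finite_Iic B).prod ((Set.finite_Iic L).prod ((Set.finite_Icc _ _).prod (Set.finite_Icc _ _)))
  let f : DyadicFace n → ℕ × ℕ × (Fin n → ℤ) × (Fin n → ℤ) :=
    fun F => (F.sheet, F.level, F.lo, F.hi)
  have hf : Function.Injective f := by
    rintro ⟨⟩ ⟨⟩ h
    simpa [f] using h
  refine (hfin.preimage hf.injOn).subset ?_
  rintro _ ⟨⟨z, hz, rfl⟩, q, hq, hqK⟩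
  -- A point of `K` has a ball of radius `δ` in `U`, which bounds its own level, and the level of
  -- any cell through it is no larger.
  have hlev : (cell U z).level ≤ L := by
    refine (cellLevel_le_of_mem hU hz hq).trans (Nat.sInf_le (star_subset_of_lt hL ?_))
    exact (Metric.ball_subset_thickening hqK δ).trans hthick
  have hq0 : dist q 0 ≤ R := hR hqK
  rw [Prod.dist_eq, max_le_iff] at hq0
  have h2L : (2 : ℝ) ^ (cell U z).level ≤ 2 ^ L := pow_le_pow_right₀ (by norm_num) hlev
  have h2 : (1 : ℝ) ≤ 2 ^ L := one_le_pow₀ (by norm_num)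
  have hRabs : R ≤ |R| := le_abs_self R
  have hcoord : ∀ i, |2 ^ (cell U z).level * q.2 i| ≤ B - 1 := by
    intro i
    have h3 : |q.2 i| ≤ |R| := by
      have := (dist_le_pi_dist q.2 (0 : ℕ × (Fin n → ℝ)).2 i).trans (hq0.2.trans hRabs)
      simpa using this
    rw [abs_mul, abs_of_pos (by positivity)]
    have := mul_le_mul h2L h3 (abs_nonneg _) (by positivity)
    linarith
  have hint : ∀ i, -(B : ℤ) ≤ (cell U z).lo i ∧ (cell U z).lo i ≤ B ∧
      -(B : ℤ) ≤ (cell U z).hi i ∧ (cell U z).hi i ≤ B := by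
    intro i
    obtain ⟨h4, h5⟩ := abs_le.1 (hcoord i)
    obtain ⟨h6, h7⟩ := hq.2 i
    have h8 : ((cell U z).lo i : ℝ) ≤ (B : ℤ) - 1 := by push_cast; linarith
    have h9 : (-(B : ℤ) : ℝ) + 1 ≤ (cell U z).hi i := by push_cast; linarith
    have h10 : (cell U z).lo i ≤ (B : ℤ) - 1 := by exact_mod_cast h8
    have h11 : -(B : ℤ) + 1 ≤ (cell U z).hi i := by exact_mod_cast h9
    have := isCubical_cell (U := U) z i
    omega
  refine ⟨?_, hlev, ⟨fun i => (hint i).1, fun i => (hint i).2.1⟩,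
    ⟨fun i => (hint i).2.2.1, fun i => (hint i).2.2.2⟩⟩
  have h12 : (q.1 : ℝ) ≤ B := by
    have : (q.1 : ℝ) ≤ R := by simpa [Nat.dist_eq] using hq0.1
    nlinarith [abs_nonneg R]
  have h13 : q.1 = (cell U z).sheet := hq.1
  rw [h13] at h12
  exact_mod_cast h12

end DyadicFace

/-! ### Null-homotopies constructed cell by cell -/

namespace DyadicFace

variable {n : ℕ} {U : Set (ℕ × (Fin n → ℝ))} {A : Type*} [TopologicalSpace A]

/-- The relative interiors of the cells partition `U`, and boundary points belong to cells of lower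
dimension; this permits definition by induction on dimension. -/
theorem mem_cells (hU : IsOpen U) {F : DyadicFace n} (hF : F ∈ cells U) {z : ℕ × (Fin n → ℝ)}
    (hz : z ∈ F.carrier) : z ∈ U ∧ (cell U z = F ∨ ((cell U z).dim < F.dim ∧ ‖F.coords z‖ = 1)) := by
  obtain ⟨z₀, hz₀, rfl⟩ := hF
  refine ⟨carrier_cell_subset hU hz₀ hz, ?_⟩
  by_cases h : ‖(cell U z₀).coords z‖ = 1
  · exact Or.inr ⟨dim_cell_lt hU hz₀ hz h, h⟩
  · exact Or.inl (cell_eq_of_norm_coords_ne hU hz₀ hz h)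

theorem isCubical_of_mem_cells {F : DyadicFace n} (hF : F ∈ cells U) : F.IsCubical := by
  obtain ⟨z, -, rfl⟩ := hF
  exact isCubical_cell z

theorem continuousOn_of_cells (hU : IsOpen U) {k : ℕ} {H : (ℕ × (Fin n → ℝ)) × ℝ → A}
    (hH : ∀ F ∈ cells U, F.dim < k → ContinuousOn H (F.carrier ×ˢ Set.Icc 0 1))
    {K : Set (ℕ × (Fin n → ℝ))} (hK : IsCompact K) (hKU : K ⊆ U)
    (hd : ∀ z ∈ K, (cell U z).dim < k) : ContinuousOn H (K ×ˢ Set.Icc 0 1) := by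
  let T := {F ∈ cells U | (F.carrier ∩ K).Nonempty}
  have hT : T.Finite := finite_cells_inter hU hK hKU
  let T' : Set (DyadicFace n) := {F ∈ T | F.dim < k}
  have hT' : Finite T' := (hT.subset (Set.sep_subset _ _)).to_subtype
  have h1 : ContinuousOn H (⋃ F : T', F.1.carrier ×ˢ Set.Icc (0 : ℝ) 1) :=
    (locallyFinite_of_finite _).continuousOn_iUnion
      (fun F => F.1.isClosed_carrier.prod isClosed_Icc) (fun F => hH F.1 F.2.1.1 F.2.2)
  refine h1.mono ?_
  rintro ⟨z, s⟩ ⟨hz, hs⟩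
  exact Set.mem_iUnion.2 ⟨⟨cell U z, ⟨⟨z, hKU hz, rfl⟩, z, mem_carrier_cell z, hz⟩, hd z hz⟩,
    mem_carrier_cell z, hs⟩

/-- The union of finitely many cells is a compact subset of `U`. -/
theorem isCompact_biUnion_cells (hU : IsOpen U) {B : Set (DyadicFace n)} (hB : B.Finite)
    (hBU : B ⊆ cells U) : IsCompact (⋃ F ∈ B, F.carrier) ∧ (⋃ F ∈ B, F.carrier) ⊆ U :=
  ⟨hB.isCompact_biUnion fun _ hF => isCompact_carrier (isCubical_of_mem_cells (hBU hF)),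
    Set.iUnion₂_subset fun _ hF _ hz => (mem_cells hU (hBU hF) hz).1⟩

/-- The finiteness clause says that the homotopies on the cells converge to `a`. It must be carried
along the induction, since it makes the boundary spheres of the next stage converge. -/
theorem exists_homotopy_cells (hU : IsOpen U) {a : A} (h : SequentiallyConnectedAt n A a)
    {G : ℕ × (Fin n → ℝ) → A} (hGc : Continuous G)
    (hG : ∀ V ∈ 𝓝 a, ∃ K ⊆ U, IsCompact K ∧ ∀ z, z ∉ K → G z ∈ V) {k : ℕ} (hk : k ≤ n + 1) :
    ∃ H : (ℕ × (Fin n → ℝ)) × ℝ → A, (∀ z, H (z, 0) = G z) ∧ (∀ z, H (z, 1) = a) ∧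
      (∀ F ∈ cells U, F.dim < k → ContinuousOn H (F.carrier ×ˢ Set.Icc 0 1)) ∧
      ∀ V ∈ 𝓝 a, {F ∈ cells U | F.dim < k ∧
        ∃ z ∈ F.carrier, ∃ s ∈ Set.Icc (0 : ℝ) 1, H (z, s) ∉ V}.Finite := by
  induction k with
  | zero =>
    -- Only the two ends matter here; the jump after time 0 is repaired cell by cell.
    refine ⟨fun q => if q.2 = 0 then G q.1 else a, fun z => by simp, fun z => by simp,
      fun F _ hF => absurd hF (Nat.not_lt_zero _), fun V _ => ?_⟩
    simp
  | succ k ih =>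
    obtain ⟨H, H0, H1, Hc, HV⟩ := ih (by omega)
    let ι := {F : DyadicFace n // F ∈ cells U ∧ F.dim = k}
    have hcub : ∀ F : ι, F.1.IsCubical := fun F => isCubical_of_mem_cells F.2.1
    have hbd : ∀ (F : ι) (z), z ∈ F.1.carrier → ‖F.1.coords z‖ = 1 → (cell U z).dim < k := by
      intro F z hz hz1
      obtain ⟨F, hFc, hF⟩ := F
      obtain ⟨z₀, hz₀, rfl⟩ := hFc
      exact (dim_cell_lt hU hz₀ hz hz1).trans_eq hF
    -- Rescaling time to `[-1, 1]` makes the boundary of the cylinder a unit sphere in the sup norm: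
    -- `G` on the bottom, `a` on the top, the earlier homotopy on the sides.
    let φ : ∀ F : ι, ℝ × (F.1.Free → ℝ) → A := fun F q => H (F.1.param q.2, (q.1 + 1) / 2)
    have hsphere : ∀ (F : ι) (q : ℝ × (F.1.Free → ℝ)), q ∈ Metric.sphere 0 1 →
        |q.1| ≤ 1 ∧ ‖q.2‖ ≤ 1 ∧ (q.1 = 1 ∨ q.1 = -1 ∨ ‖q.2‖ = 1) := by
      intro F q hq
      rw [mem_sphere_zero_iff_norm, Prod.norm_def, Real.norm_eq_abs] at hq
      refine ⟨hq ▸ le_max_left _ _, hq ▸ le_max_right _ _, ?_⟩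
      rcases max_choice |q.1| ‖q.2‖ with hm | hm <;> rw [hm] at hq
      · rcases (abs_eq zero_le_one).1 hq with h | h <;> simp [h]
      · exact Or.inr (Or.inr hq)
    have hφc : ∀ F, ContinuousOn (φ F) (Metric.sphere 0 1) := by
      intro F
      have c1 : ContinuousOn (φ F) {q | q.1 = 1} := by
        refine (continuousOn_const (c := a)).congr fun q hq => ?_
        have hq : q.1 = 1 := hq
        simp only [φ, hq]; norm_num [H1]
      have c2 : ContinuousOn (φ F) {q | q.1 = -1} := by
        refine ((hGc.comp (F.1.continuous_param.comp continuous_snd)).continuousOn).congr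
          fun q hq => ?_
        have hq : q.1 = -1 := hq
        simp only [φ, hq]; norm_num [H0]
      have c3 : ContinuousOn (φ F) {q | |q.1| ≤ 1 ∧ ‖q.2‖ = 1} := by
        have hK : IsCompact (F.1.carrier ∩ {z | ‖F.1.coords z‖ = 1}) :=
          (isCompact_carrier (hcub F)).inter_right
            (isClosed_eq F.1.continuous_coords.norm continuous_const)
        have := continuousOn_of_cells hU Hc hK (fun z hz => (mem_cells hU F.2.1 hz.1).1)
          (fun z hz => hbd F z hz.1 hz.2)
        refine this.comp ?_ ?_
        · exact ((F.1.continuous_param.comp continuous_snd).prodMk (by fun_prop)).continuousOn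
        · rintro q ⟨hq1, hq2⟩
          rw [abs_le] at hq1
          refine ⟨⟨(hcub F).param_mem hq2.le, ?_⟩, by linarith, by linarith⟩
          rw [Set.mem_ofPred_eq, coords_param, hq2]
      have cl1 : IsClosed {q : ℝ × (F.1.Free → ℝ) | q.1 = 1} :=
        isClosed_eq continuous_fst continuous_const
      have cl2 : IsClosed {q : ℝ × (F.1.Free → ℝ) | q.1 = -1} :=
        isClosed_eq continuous_fst continuous_const
      have cl3 : IsClosed {q : ℝ × (F.1.Free → ℝ) | |q.1| ≤ 1 ∧ ‖q.2‖ = 1} :=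
        (isClosed_le continuous_fst.abs continuous_const).inter
          (isClosed_eq continuous_snd.norm continuous_const)
      refine (c1.union_of_isClosed (c2.union_of_isClosed c3 cl2 cl3) cl1 (cl2.union cl3)).mono ?_
      intro q hq
      obtain ⟨h1, -, h2 | h2 | h2⟩ := hsphere F q hq
      · exact Or.inl h2
      · exact Or.inr (Or.inl h2)
      · exact Or.inr (Or.inr ⟨h1, h2⟩)
    have hφa : ∀ F, φ F (1, 0) = a := fun F => by simp only [φ]; norm_num [H1]
    have hφV : ∀ V ∈ 𝓝 a, ∀ᶠ F in cofinite, ∀ q ∈ Metric.sphere 0 1, φ F q ∈ V := by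
      intro V hV
      obtain ⟨K, hKU, hK, hKV⟩ := hG V hV
      obtain ⟨hK', hKU'⟩ := isCompact_biUnion_cells hU (HV V hV) (Set.sep_subset _ _)
      set K' := ⋃ F ∈ {F ∈ cells U | F.dim < k ∧
        ∃ z ∈ F.carrier, ∃ s ∈ Set.Icc (0 : ℝ) 1, H (z, s) ∉ V}, F.carrier
      -- A sphere can leave `V` only through its bottom, over `K`, or through its sides, over a bad
      -- cell of lower dimension. Both regions are compact in `U`, so few cells meet them.
      have hfin := finite_cells_inter hU (hK.union hK') (Set.union_subset hKU hKU')
      refine (hfin.preimage Subtype.val_injective.injOn).subset fun F hF => ⟨F.2.1, ?_⟩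
      by_contra hne
      have hdisj : ∀ z ∈ F.1.carrier, z ∉ K ∧ z ∉ K' := fun z hz =>
        ⟨fun hzK => hne ⟨z, hz, Or.inl hzK⟩, fun hzK => hne ⟨z, hz, Or.inr hzK⟩⟩
      refine hF fun q hq => ?_
      obtain ⟨h1, h2, h3⟩ := hsphere F q hq
      have hmem := (hcub F).param_mem h2
      rcases h3 with h3 | h3 | h3
      · have : φ F q = a := by simp only [φ, h3]; norm_num [H1]
        rw [this]; exact mem_of_mem_nhds hV
      · have : φ F q = G (F.1.param q.2) := by simp only [φ, h3]; norm_num [H0]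
        rw [this]; exact hKV _ (hdisj _ hmem).1
      · by_contra hbad
        rw [abs_le] at h1
        refine (hdisj _ hmem).2 (Set.mem_biUnion (x := cell U (F.1.param q.2))
          ⟨⟨_, (mem_cells hU F.2.1 hmem).1, rfl⟩, hbd F _ hmem (by rw [coords_param, h3]),
            _, mem_carrier_cell _, (q.1 + 1) / 2, ⟨by linarith, by linarith⟩, hbad⟩
          (mem_carrier_cell _))
    obtain ⟨Φ, Φc, Φφ, ΦV⟩ := h.exists_extension (by omega : k ≤ n) (fun F : ι => F.2.2) φ hφc hφa hφV
    let Ψ : ι → (ℕ × (Fin n → ℝ)) × ℝ → A := fun F q => Φ F (2 * q.2 - 1, F.1.coords q.1)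
    have Ψc : ∀ F, Continuous (Ψ F) := fun F =>
      (Φc F).comp ((by fun_prop : Continuous fun q : (ℕ × (Fin n → ℝ)) × ℝ => 2 * q.2 - 1).prodMk
        (F.1.continuous_coords.comp continuous_fst))
    have ΨH : ∀ (F : ι) (z) (s : ℝ), z ∈ F.1.carrier → s ∈ Set.Icc (0 : ℝ) 1 →
        (s = 0 ∨ s = 1 ∨ ‖F.1.coords z‖ = 1) → Ψ F (z, s) = H (z, s) := by
      intro F z s hz hs hor
      have h1 : |2 * s - 1| ≤ 1 := abs_le.2 ⟨by linarith [hs.1], by linarith [hs.2]⟩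
      have hsph : ((2 * s - 1, F.1.coords z) : ℝ × (F.1.Free → ℝ)) ∈ Metric.sphere 0 1 := by
        rw [mem_sphere_zero_iff_norm, Prod.norm_def, Real.norm_eq_abs]
        refine le_antisymm (max_le h1 ((hcub F).norm_coords_le hz)) ?_
        rcases hor with rfl | rfl | h
        · exact le_max_of_le_left (by norm_num)
        · exact le_max_of_le_left (by norm_num)
        · exact le_max_of_le_right h.ge
      change Φ F _ = _
      rw [Φφ F _ hsph]
      simp only [φ, param_coords hz]
      congr 2
      ring
    classical
    let H' : (ℕ × (Fin n → ℝ)) × ℝ → A := fun q =>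
      if hq : cell U q.1 ∈ cells U ∧ (cell U q.1).dim = k then Ψ ⟨cell U q.1, hq⟩ q else H q
    have H'lt : ∀ F ∈ cells U, F.dim < k → ∀ z ∈ F.carrier, ∀ s, H' (z, s) = H (z, s) := by
      intro F hF hFk z hz s
      refine dif_neg fun hq => ?_
      have h2 : (cell U z).dim = k := hq.2
      rcases (mem_cells hU hF hz).2 with h3 | h3
      · rw [h3] at h2; omega
      · omega
    have H'eq : ∀ (F : ι) (z), z ∈ F.1.carrier → ∀ s ∈ Set.Icc (0 : ℝ) 1,
        H' (z, s) = Ψ F (z, s) := by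
      intro F z hz s hs
      rcases (mem_cells hU F.2.1 hz).2 with h3 | h3
      · have hq : cell U z ∈ cells U ∧ (cell U z).dim = k := h3 ▸ F.2
        have : (⟨cell U z, hq⟩ : ι) = F := Subtype.ext h3
        rw [← this]
        exact dif_pos hq
      · rw [ΨH F z s hz hs (Or.inr (Or.inr h3.2))]
        refine dif_neg fun hq => ?_
        have h2 : (cell U z).dim = k := hq.2
        have := F.2.2
        omega
    have H'end : ∀ z s, s = 0 ∨ s = 1 → H' (z, s) = H (z, s) := by
      intro z s hs
      by_cases hq : cell U z ∈ cells U ∧ (cell U z).dim = k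
      · have hs' : s ∈ Set.Icc (0 : ℝ) 1 := by rcases hs with rfl | rfl <;> simp
        rw [H'eq ⟨cell U z, hq⟩ z (mem_carrier_cell z) s hs',
          ΨH ⟨cell U z, hq⟩ z s (mem_carrier_cell z) hs' (by tauto)]
      · exact dif_neg hq
    refine ⟨H', fun z => by rw [H'end z 0 (Or.inl rfl), H0], fun z => by
      rw [H'end z 1 (Or.inr rfl), H1], fun F hF hFk => ?_, fun V hV => ?_⟩
    · rcases Nat.lt_succ_iff_lt_or_eq.1 hFk with hlt | heq
      · exact (Hc F hF hlt).congr fun q hq => H'lt F hF hlt q.1 hq.1 q.2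
      · exact (Ψc ⟨F, hF, heq⟩).continuousOn.congr fun q hq =>
          H'eq ⟨F, hF, heq⟩ q.1 hq.1 q.2 hq.2
    · refine ((HV V hV).union ((ΦV V hV).image Subtype.val)).subset ?_
      rintro F ⟨hF, hFk, z, hz, s, hs, hbad⟩
      rcases Nat.lt_succ_iff_lt_or_eq.1 hFk with hlt | heq
      · rw [H'lt F hF hlt z hz] at hbad
        exact Or.inl ⟨hF, hlt, z, hz, s, hs, hbad⟩
      · rw [H'eq ⟨F, hF, heq⟩ z hz s hs] at hbad
        exact Or.inr ⟨⟨F, hF, heq⟩, fun hall => hbad (hall _), rfl⟩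

end DyadicFace

/-- A map `ℕ × ℝⁿ → A` tending to `a` at infinity is null-homotopic, relative to the preimage of
`a`, through maps tending to `a` at infinity. -/
theorem SequentiallyConnectedAt.exists_nullhomotopy_rel {n : ℕ} {A : Type*} [TopologicalSpace A]
    [T1Space A] {a : A} (h : SequentiallyConnectedAt n A a) {G : ℕ × (Fin n → ℝ) → A}
    (hGc : Continuous G) (hG : Tendsto G (cocompact _) (𝓝 a)) :
    ∃ H : I × (ℕ × (Fin n → ℝ)) → A, Continuous H ∧ (∀ z, H (0, z) = G z) ∧ (∀ z, H (1, z) = a) ∧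
      (∀ s z, G z = a → H (s, z) = a) ∧
      ∀ V ∈ 𝓝 a, ∃ K, IsCompact K ∧ ∀ s, ∀ z, z ∉ K → H (s, z) ∈ V := by
  set U : Set (ℕ × (Fin n → ℝ)) := G ⁻¹' {a}ᶜ
  have hU : IsOpen U := isOpen_compl_singleton.preimage hGc
  -- Cutting the compact set down to where `G` avoids an open neighbourhood of `a` keeps it inside
  -- `U`, so values are also controlled near the frontier of `U`.
  have hG' : ∀ V ∈ 𝓝 a, ∃ K ⊆ U, IsCompact K ∧ ∀ z, z ∉ K → G z ∈ V := by
    intro V hV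
    obtain ⟨W, hWV, hW, haW⟩ := mem_nhds_iff.1 hV
    obtain ⟨K, hK, hKV⟩ := mem_cocompact.1 (hG (hW.mem_nhds haW))
    refine ⟨K ∩ G ⁻¹' Wᶜ, fun z hz hza => hz.2 ?_, hK.inter_right (hW.isClosed_compl.preimage hGc),
      fun z hz => ?_⟩
    · have : G z = a := hza
      rw [this]; exact haW
    · by_cases hzK : z ∈ K
      · by_contra hzV
        exact hz ⟨hzK, fun hzW => hzV (hWV hzW)⟩
      · exact hWV (hKV hzK)
  obtain ⟨H, H0, H1, Hc, HV⟩ := DyadicFace.exists_homotopy_cells hU h hGc hG' le_rfl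
  classical
  let H' : I × (ℕ × (Fin n → ℝ)) → A := fun q => if q.2 ∈ U then H (q.2, q.1) else a
  have hV' : ∀ V ∈ 𝓝 a, ∃ K ⊆ U, IsCompact K ∧ ∀ s, ∀ z, z ∉ K → H' (s, z) ∈ V := by
    intro V hV
    obtain ⟨hK, hKU⟩ := DyadicFace.isCompact_biUnion_cells hU (HV V hV) (Set.sep_subset _ _)
    refine ⟨_, hKU, hK, fun s z hz => ?_⟩
    by_cases hzU : z ∈ U
    · by_contra hbad
      simp only [H', hzU, if_true] at hbad
      exact hz (Set.mem_biUnion (x := DyadicFace.cell U z) ⟨⟨z, hzU, rfl⟩,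
        Nat.lt_succ_of_le (DyadicFace.dim_le _), z, DyadicFace.mem_carrier_cell z, s, s.2, hbad⟩
        (DyadicFace.mem_carrier_cell z))
    · simp only [H', hzU, if_false]
      exact mem_of_mem_nhds hV
  refine ⟨H', continuous_iff_continuousAt.2 ?_, fun z => ?_, fun z => ?_, fun s z hz => ?_,
    fun V hV => ?_⟩
  · rintro ⟨s, z⟩
    by_cases hz : z ∈ U
    · obtain ⟨K, hKz, hKU, hK⟩ := local_compact_nhds (hU.mem_nhds hz)
      have hcon := DyadicFace.continuousOn_of_cells hU Hc hK hKU
        fun z _ => Nat.lt_succ_of_le (DyadicFace.dim_le _)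
      have hcon' : ContinuousOn (fun q : I × (ℕ × (Fin n → ℝ)) => H (q.2, q.1))
          (Set.univ ×ˢ K) :=
        hcon.comp (by fun_prop) fun q hq => ⟨hq.2, q.1.2⟩
      have hcon'' : ContinuousOn H' (Set.univ ×ˢ K) :=
        hcon'.congr fun q hq => if_pos (hKU hq.2)
      exact hcon''.continuousAt (prod_mem_nhds univ_mem hKz)
    · intro V hV
      have hval : H' (s, z) = a := if_neg hz
      rw [hval] at hV
      obtain ⟨K, hKU, hK, hKV⟩ := hV' V hV
      -- Off `U`, continuity holds because the points where the homotopy can leave `V` lie over a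
      -- compact subset of `U`.
      have hzK : Kᶜ ∈ 𝓝 z := hK.isClosed.isOpen_compl.mem_nhds fun h => hz (hKU h)
      rw [mem_map]
      filter_upwards [prod_mem_nhds (univ_mem (f := 𝓝 s)) hzK] with q hq using hKV _ _ hq.2
  · by_cases hz : z ∈ U
    · simp [H', hz, H0]
    · have : G z = a := by simpa [U] using hz
      simp [H', hz, this]
  · simp [H', H1]
  · have : z ∉ U := fun h => h hz
    simp [H', this]
  · obtain ⟨K, -, hK, hKV⟩ := hV' V hV
    exact ⟨K, hK, hKV⟩

/-! ### Null-homotopies on compactifications of `ℝⁿ` -/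

section

variable {n : ℕ} {A : Type*} [TopologicalSpace A] {a : A} {K : Type*} [TopologicalSpace K]
  {j : (Fin n → ℝ) → K}

/-- Outside the range of `j` every map equals `a`, so the points sent outside an open neighbourhood
of `a` form a compact subset of `ℝⁿ`. Convergence leaves only finitely many sheets to consider. -/
theorem ConvergesToPoint.tendsto_cocompact [CompactSpace K] (hj : IsOpenEmbedding j) {g : ℕ → C(K, A)}
    (hg : ConvergesToPoint g a) (hgj : ∀ m, ∀ p ∉ Set.range j, g m p = a) :
    Tendsto (fun z : ℕ × (Fin n → ℝ) => g z.1 (j z.2)) (cocompact _) (𝓝 a) := by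
  intro V hV
  obtain ⟨W, hWV, hW, haW⟩ := mem_nhds_iff.1 hV
  obtain ⟨N, hN⟩ := eventually_atTop.1 (hg W (hW.mem_nhds haW))
  have hcpt : ∀ m, IsCompact (j ⁻¹' (g m ⁻¹' Wᶜ)) := by
    intro m
    refine hj.isInducing.isCompact_preimage' (hW.isClosed_compl.preimage (g m).continuous).isCompact
      fun p hp => ?_
    by_contra hpj
    refine hp ?_
    rw [hgj m p hpj]
    exact haW
  have hK : IsCompact (⋃ m ∈ Set.Iio N, ({m} : Set ℕ) ×ˢ (j ⁻¹' (g m ⁻¹' Wᶜ))) :=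
    (Set.finite_Iio N).isCompact_biUnion fun m _ => isCompact_singleton.prod (hcpt m)
  refine mem_cocompact.2 ⟨_, hK, ?_⟩
  rintro ⟨m, z⟩ hz
  refine hWV ?_
  by_contra hbad
  refine hz (Set.mem_biUnion (x := m) ?_ (Set.mk_mem_prod rfl hbad))
  by_contra hm
  exact hbad (hN m (not_lt.1 hm) (Set.mem_range_self _))

/-- A map on `I × ℝⁿ` tending to `a` at infinity extends to a compactification of `ℝⁿ`. -/
theorem exists_continuous_extension_of_isOpenEmbedding [T2Space K] (hj : IsOpenEmbedding j)
    {H : I × (Fin n → ℝ) → A} (hc : Continuous H)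
    (hV : ∀ V ∈ 𝓝 a, ∃ C, IsCompact C ∧ ∀ s, ∀ x, x ∉ C → H (s, x) ∈ V) :
    ∃ H' : C(I × K, A), (∀ s x, H' (s, j x) = H (s, x)) ∧
      ∀ s, ∀ p ∉ Set.range j, H' (s, p) = a := by
  let H' : I × K → A := fun q => Function.extend j (fun x => H (q.1, x)) (fun _ => a) q.2
  have hH'j : ∀ s x, H' (s, j x) = H (s, x) := fun s x => hj.injective.extend_apply _ _ _
  have hH'a : ∀ s p, p ∉ Set.range j → H' (s, p) = a := fun s p hp =>
    Function.extend_apply' _ _ _ hp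
  refine ⟨⟨H', continuous_iff_continuousAt.2 ?_⟩, hH'j, hH'a⟩
  rintro ⟨s, p⟩
  by_cases hp : p ∈ Set.range j
  · obtain ⟨x, rfl⟩ := hp
    have he : IsOpenEmbedding (Prod.map (id : I → I) j) := IsOpenEmbedding.id.prodMap hj
    refine (he.continuousAt_iff (x := (s, x))).1 (Continuous.continuousAt ?_)
    have : H' ∘ Prod.map id j = H := funext fun q => hH'j q.1 q.2
    rw [this]
    exact hc
  · intro V hVa
    rw [hH'a s p hp] at hVa
    obtain ⟨C, hC, hCV⟩ := hV V hVa
    have hpC : (j '' C)ᶜ ∈ 𝓝 p :=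
      (hC.image hj.continuous).isClosed.isOpen_compl.mem_nhds fun ⟨x, _, hx⟩ => hp ⟨x, hx⟩
    rw [mem_map]
    filter_upwards [prod_mem_nhds (univ_mem (f := 𝓝 s)) hpC]
    rintro ⟨t, q⟩ ⟨-, hq⟩
    by_cases hqj : q ∈ Set.range j
    · obtain ⟨x, rfl⟩ := hqj
      rw [Set.mem_preimage, hH'j]
      exact hCV _ _ fun hxC => hq ⟨x, hxC, rfl⟩
    · rw [Set.mem_preimage, hH'a t q hqj]
      exact mem_of_mem_nhds hVa

theorem SequentiallyConnectedAt.exists_nullhomotopy_of_isOpenEmbedding [CompactSpace K] [T2Space K]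
    [T1Space A]
    (h : SequentiallyConnectedAt n A a) (hj : IsOpenEmbedding j) (g : ℕ → C(K, A))
    (hg : ConvergesToPoint g a) (hgj : ∀ m, ∀ p ∉ Set.range j, g m p = a) :
    ∃ H : ℕ → C(I × K, A), (∀ m p, H m (0, p) = g m p) ∧ (∀ m p, H m (1, p) = a) ∧
      (∀ m s p, g m p = a → H m (s, p) = a) ∧ ConvergesToPoint H a := by
  obtain ⟨H, Hc, H0, H1, Ha, HV⟩ := h.exists_nullhomotopy_rel
    (G := fun z : ℕ × (Fin n → ℝ) => g z.1 (j z.2))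
    (continuous_prod_of_discrete_left.2 fun m => (g m).continuous.comp hj.continuous)
    (hg.tendsto_cocompact hj hgj)
  have hext := fun m : ℕ => exists_continuous_extension_of_isOpenEmbedding (a := a) hj
    (H := fun q => H (q.1, (m, q.2))) (by fun_prop) (fun V hV => by
      obtain ⟨C, hC, hCV⟩ := HV V hV
      exact ⟨_, hC.image continuous_snd, fun s x hx => hCV _ _ fun hxC => hx ⟨(m, x), hxC, rfl⟩⟩)
  choose H' H'j H'a using hext
  refine ⟨H', fun m p => ?_, fun m p => ?_, fun m s p hp => ?_, fun V hV => ?_⟩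
  · by_cases hp : p ∈ Set.range j
    · obtain ⟨x, rfl⟩ := hp
      exact (H'j m 0 x).trans (H0 _)
    · exact (H'a m 0 p hp).trans (hgj m p hp).symm
  · by_cases hp : p ∈ Set.range j
    · obtain ⟨x, rfl⟩ := hp
      exact (H'j m 1 x).trans (H1 _)
    · exact H'a m 1 p hp
  · by_cases hp' : p ∈ Set.range j
    · obtain ⟨x, rfl⟩ := hp'
      exact (H'j m s x).trans (Ha s (m, x) hp)
    · exact H'a m s p hp'
  · obtain ⟨C, hC, hCV⟩ := HV V hV
    -- A compact subset of `ℕ × ℝⁿ` meets finitely many sheets, so vanishing at infinity yields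
    -- convergence of the sequence.
    have hfin : (Prod.fst '' C).Finite := (hC.image continuous_fst).finite_of_discrete
    rw [← Nat.cofinite_eq_atTop]
    filter_upwards [hfin.compl_mem_cofinite] with m hm
    rintro _ ⟨⟨s, p⟩, rfl⟩
    by_cases hp : p ∈ Set.range j
    · obtain ⟨x, rfl⟩ := hp
      rw [H'j]
      exact hCV _ _ fun hx => hm ⟨(m, x), hx, rfl⟩
    · rw [H'a m s p hp]
      exact mem_of_mem_nhds hV

end

/-! ### Deformation into the core -/

namespace ShrinkingAdj

variable {X : Type*} [TopologicalSpace X] [T1Space X] {x : ℕ → X} {A : ℕ → Type*}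
  [∀ j, TopologicalSpace (A j)] [∀ j, T1Space (A j)] {a : ∀ j, A j} {n : ℕ} {K : Type*}
  [TopologicalSpace K] [CompactSpace K] [T2Space K] {e : (Fin n → ℝ) → K}

/-- A sequence of maps into a shrinking adjunction space that converges to a point of the core can
be deformed into the core, keeping fixed everything that is mapped to the core. -/
theorem exists_homotopy_core (hA : ∀ j, SequentiallyConnectedAt n (A j) (a j))
    (he : IsOpenEmbedding e) {y₀ : X} (f : ℕ → C(K, ShrinkingAdj x A a))
    (hf : ConvergesToPoint f (core x A a y₀))
    (hfe : ∀ m, ∀ p ∉ Set.range e, f m p ∈ Set.range (core x A a)) :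
    ∃ H : ℕ → C(I × K, ShrinkingAdj x A a), (∀ m p, H m (0, p) = f m p) ∧
      (∀ m p, H m (1, p) = core x A a (retraction x A a (f m p))) ∧
      (∀ m s p, f m p ∈ Set.range (core x A a) → H m (s, p) = f m p) ∧
      ConvergesToPoint H (core x A a y₀) := by
  have hcore : ∀ j y, y ∈ Set.range (core x A a) → coord x A a j y = a j := by
    rintro j _ ⟨p, rfl⟩; rfl
  have key := fun i => (hA i).exists_nullhomotopy_of_isOpenEmbedding he
    (fun m => (⟨_, continuous_coord x A a i⟩ : C(ShrinkingAdj x A a, A i)).comp (f m))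
    (by
      rw [convergesToPoint_iff_tendsto] at hf ⊢
      exact ((continuous_coord x A a i).tendsto (core x A a y₀)).comp hf)
    (fun m p hp => hcore i _ (hfe m p hp))
  choose H H0 H1 Ha Hc using key
  -- Here the relative contraction is essential: a coordinate that is nontrivial at some time was
  -- nontrivial at the start, so all others were trivial and remain so.
  have hmem : ∀ m (q : I × K), (retraction x A a (f m q.2), fun i => H i m q) ∈ AdjCoords x A a := by
    rintro m ⟨s, p⟩ i hi
    have h1 : coord x A a i (f m p) ≠ a i := fun h => hi (Ha i m s p h)
    obtain ⟨h2, h3⟩ := coords_mem x A a (f m p) i h1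
    exact ⟨h2, fun k hk => Ha k m s p (h3 k hk)⟩
  let φ := coordsHomeomorph x A a
  have hφ : ∀ y, φ y = ⟨(retraction x A a y, fun i => coord x A a i y), coords_mem x A a y⟩ :=
    fun _ => rfl
  refine ⟨fun m => ⟨fun q => φ.symm ⟨_, hmem m q⟩, φ.symm.continuous.comp ?_⟩,
    fun m p => ?_, fun m p => ?_, fun m s p hp => ?_, ?_⟩
  · refine Continuous.subtype_mk (Continuous.prodMk ?_ (continuous_pi fun i => (H i m).continuous)) _
    exact ((retraction x A a).continuous.comp (f m).continuous).comp continuous_snd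
  · refine φ.symm_apply_eq.2 (Subtype.ext (Prod.ext rfl (funext fun i => H0 i m p)))
  · refine φ.symm_apply_eq.2 (Subtype.ext (Prod.ext rfl (funext fun i => H1 i m p)))
  · refine φ.symm_apply_eq.2 (Subtype.ext (Prod.ext rfl (funext fun i => ?_)))
    exact (Ha i m s p (hcore i _ hp)).trans (hcore i _ hp).symm
  · rw [convergesToPoint_iff_tendsto] at hf ⊢
    rw [← φ.symm_apply_apply (core x A a y₀)]
    refine (φ.symm.continuous.tendsto _).comp (tendsto_subtype_rng.2 (Tendsto.prodMk_nhds ?_ ?_))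
    · have h1 : Tendsto (fun q : ℕ × (I × K) => (q.1, q.2.2)) (atTop ×ˢ ⊤) (atTop ×ˢ (⊤ : Filter K)) :=
        tendsto_fst.prodMk tendsto_top
      exact (((retraction x A a).continuous.tendsto _).comp hf).comp h1
    · exact tendsto_pi_nhds.2 fun i => (convergesToPoint_iff_tendsto _ _).1 (Hc i)

theorem homotopicRel_core (hA : ∀ j, SequentiallyConnectedAt n (A j) (a j))
    (he : IsOpenEmbedding e) (f : C(K, ShrinkingAdj x A a))
    (hfe : ∀ p ∉ Set.range e, f p ∈ Set.range (core x A a)) {S : Set K}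
    (hS : ∀ p ∈ S, f p ∈ Set.range (core x A a)) (y₀ : X) :
    ContinuousMap.HomotopicRel f (((core x A a).comp (retraction x A a)).comp f) S := by
  obtain ⟨H, H0, H1, Ha, -⟩ := exists_homotopy_core hA he (y₀ := y₀)
    -- A single map is placed in a convergent sequence by making all later terms constant.
    (fun m => if m = 0 then f else ContinuousMap.const K (core x A a y₀))
    (fun U hU => by
      filter_upwards [eventually_ne_atTop 0] with m hm
      rw [if_neg hm]
      rintro _ ⟨p, rfl⟩
      exact mem_of_mem_nhds hU)
    (fun m p hp => by
      by_cases hm : m = 0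
      · rw [if_pos hm]; exact hfe p hp
      · rw [if_neg hm]; exact ⟨y₀, rfl⟩)
  exact ⟨⟨⟨H 0, H0 0, H1 0⟩, fun s p hp => Ha 0 s p (hS p hp)⟩⟩

end ShrinkingAdj

/-! ### Cubes and spheres as compactifications of `ℝⁿ` -/

theorem isOpenEmbedding_piMap_sigmoid (n : ℕ) :
    IsOpenEmbedding (Pi.map fun _ : Fin n => unitInterval.sigmoid) :=
  IsOpenEmbedding.piMap fun _ =>
    ⟨Topology.isEmbedding_sigmoid, by rw [unitInterval.range_sigmoid]; exact isOpen_Ioo⟩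

theorem mem_boundary_of_notMem_range_sigmoid {n : ℕ} {p : Fin n → I}
    (hp : p ∉ Set.range (Pi.map fun _ : Fin n => unitInterval.sigmoid)) :
    p ∈ Cube.boundary (Fin n) := by
  by_contra hb
  refine hp ?_
  have : ∀ i, p i ∈ Set.range unitInterval.sigmoid := by
    intro i
    rw [unitInterval.range_sigmoid]
    refine ⟨unitInterval.pos_iff_ne_zero.2 fun h => hb ⟨i, Or.inl h⟩,
      unitInterval.lt_one_iff_ne_one.2 fun h => hb ⟨i, Or.inr h⟩⟩
  choose w hw using this
  exact ⟨w, funext hw⟩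

theorem UnitSphere.exists_isOpenEmbedding (k : ℕ) :
    ∃ e : (Fin k → ℝ) → UnitSphere k, IsOpenEmbedding e ∧ Set.range e = {UnitSphere.base k}ᶜ := by
  have : Fact (Module.finrank ℝ (EuclideanSpace ℝ (Fin (k + 1))) = k + 1) := ⟨by simp⟩
  let s := stereographic' k (UnitSphere.base k)
  have hs : IsOpenEmbedding s.symm :=
    s.symm.isOpenEmbedding (by simp [s])
  refine ⟨s.symm ∘ (EuclideanSpace.equiv (Fin k) ℝ).symm,
    hs.comp (EuclideanSpace.equiv (Fin k) ℝ).symm.toHomeomorph.isOpenEmbedding, ?_⟩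
  rw [Set.range_comp, (EuclideanSpace.equiv (Fin k) ℝ).symm.surjective.range_eq]
  have := s.symm.image_source_eq_target
  simpa [s] using this

/-! ### Induced maps on homotopy groups -/

theorem HomotopyGroup.induced_mul {X Y : Type*} [TopologicalSpace X] [TopologicalSpace Y] {x : X}
    {y : Y} (h : C(X, Y)) (hxy : h x = y) (m : ℕ) (p q : HomotopyGroup.Pi (m + 1) X x) :
    HomotopyGroup.induced h hxy (m + 1) (p * q) =
      HomotopyGroup.induced h hxy (m + 1) p * HomotopyGroup.induced h hxy (m + 1) q := by
  induction p, q using Quotient.inductionOn₂ with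
  | h p q =>
    have h1 := HomotopyGroup.mul_spec (i := (0 : Fin (m + 1))) (p := p) (q := q)
    have h2 := HomotopyGroup.mul_spec (i := (0 : Fin (m + 1)))
      (p := GenLoop.postcomp h hxy p) (q := GenLoop.postcomp h hxy q)
    refine (congrArg _ h1).trans (Eq.trans ?_ h2.symm)
    refine congrArg (Quotient.mk _) (GenLoop.ext _ _ fun t => ?_)
    change h (GenLoop.transAt 0 q p t) = _
    simp only [GenLoop.transAt, GenLoop.coe_copy]
    split_ifs <;> rfl

namespace ShrinkingAdj

variable {X : Type*} [TopologicalSpace X] [T1Space X] {x : ℕ → X} {A : ℕ → Type*}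
  [∀ j, TopologicalSpace (A j)] [∀ j, T1Space (A j)] {a : ∀ j, A j} {n : ℕ}

theorem sequentiallyHomotopicRel_core (hA : ∀ j, SequentiallyConnectedAt n (A j) (a j)) (y₀ : X)
    (f : ℕ → GenLoop (Fin n) (ShrinkingAdj x A a) (core x A a y₀))
    (hf : ConvergesToPoint (fun m => (f m).1) (core x A a y₀)) :
    SequentiallyHomotopicRel (Cube.boundary (Fin n)) (fun m => (f m).1)
      (fun m => ((core x A a).comp (retraction x A a)).comp (f m).1) (core x A a y₀) := by
  obtain ⟨H, H0, H1, Ha, Hc⟩ := exists_homotopy_core hA (isOpenEmbedding_piMap_sigmoid n)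
    (fun m => (f m).1) hf
    fun m p hp => ⟨y₀, ((f m).2 p (mem_boundary_of_notMem_range_sigmoid hp)).symm⟩
  refine ⟨hf, ?_, fun m => ⟨⟨H m, H0 m, H1 m⟩, fun s p hp =>
    Ha m s p ⟨y₀, ((f m).2 p hp).symm⟩⟩, Hc⟩
  rw [convergesToPoint_iff_tendsto] at hf ⊢
  exact (((core x A a).comp (retraction x A a)).continuous.tendsto (core x A a y₀)).comp hf

/-- The restrictions to the spheres converge to the image of the wedge point, so they deform
simultaneously and convergently, and the homotopies glue. -/
theorem homotopicRel_core_of_hawaiianEarring {k : ℕ}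
    (hA : ∀ j, SequentiallyConnectedAt k (A j) (a j)) (y₀ : X)
    (F : C(HawaiianEarring k, ShrinkingAdj x A a))
    (hF : F (HawaiianEarring.base k) = core x A a y₀) :
    ContinuousMap.HomotopicRel F (((core x A a).comp (retraction x A a)).comp F)
      {HawaiianEarring.base k} := by
  obtain ⟨e, he, hrange⟩ := UnitSphere.exists_isOpenEmbedding k
  have hb : ∀ m, F (ShrinkingWedge.incl _ _ m (UnitSphere.base k)) = core x A a y₀ := fun m =>
    (congrArg F (ShrinkingWedge.incl_basepoint _ _ m)).trans hF
  obtain ⟨H, H0, H1, Ha, Hc⟩ := exists_homotopy_core hA he _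
    (ShrinkingWedge.convergesToPoint_comp_incl F hF)
    (fun m p hp => by
      have : p = UnitSphere.base k := by simpa [hrange] using hp
      rw [this]
      exact ⟨y₀, (hb m).symm⟩)
  obtain ⟨L, hL⟩ := ShrinkingWedge.exists_homotopy_lift H
    (fun m t => (Ha m t _ ⟨y₀, (hb m).symm⟩).trans (hb m)) Hc
  refine ⟨⟨⟨L, ?_, ?_⟩, ?_⟩⟩
  · rintro ⟨m, p⟩
    exact (hL m 0 p).trans (H0 m p)
  · rintro ⟨m, p⟩
    exact (hL m 1 p).trans (H1 m p)
  · rintro t _ rfl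
    exact (hL 0 t _).trans (Ha 0 t _ ⟨y₀, (hb 0).symm⟩)

theorem sequentiallyConnectedAt_core (hA : ∀ j, SequentiallyConnectedAt n (A j) (a j)) {y₀ : X}
    (hX : SequentiallyConnectedAt n X y₀) :
    SequentiallyConnectedAt n (ShrinkingAdj x A a) (core x A a y₀) := by
  intro k hk
  have hnull : ∀ F : BasedMap (HawaiianEarring k) (HawaiianEarring.base k) (ShrinkingAdj x A a)
      (core x A a y₀), ContinuousMap.HomotopicRel F.1 (ContinuousMap.const _ (core x A a y₀))
        {HawaiianEarring.base k} := by
    rintro ⟨F, hF⟩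
    refine (homotopicRel_core_of_hawaiianEarring (fun j => (hA j).mono hk) y₀ F hF).trans ?_
    have : Subsingleton (Quotient (basedHomotopySetoid _ (HawaiianEarring.base k) X y₀)) := hX k hk
    have heq := Subsingleton.elim
      (Quotient.mk (basedHomotopySetoid _ (HawaiianEarring.base k) X y₀)
        ⟨(retraction x A a).comp F, by rw [ContinuousMap.comp_apply, hF, retraction_core]⟩)
      (Quotient.mk _ ⟨ContinuousMap.const _ y₀, rfl⟩)
    have hrel : ContinuousMap.HomotopicRel ((retraction x A a).comp F)
        (ContinuousMap.const _ y₀) {HawaiianEarring.base k} := Quotient.exact heq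
    exact hrel.comp_continuousMap (core x A a)
  refine ⟨fun p q => ?_⟩
  induction p using Quotient.inductionOn with
  | h p =>
    induction q using Quotient.inductionOn with
    | h q => exact Quotient.sound ((hnull p).trans (hnull q).symm)

/-- Surjectivity uses that `r` is a strict left inverse of the core inclusion. For injectivity, each
loop deforms onto its retracted copy in the core, rel boundary. -/
theorem bijective_induced_retraction (hA : ∀ j, SequentiallyConnectedAt n (A j) (a j)) (y₀ : X) :
    Function.Bijective
      (HomotopyGroup.induced (retraction x A a) (retraction_core x A a y₀) n) := by
  have hrel : ∀ f : GenLoop (Fin n) (ShrinkingAdj x A a) (core x A a y₀),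
      ContinuousMap.HomotopicRel f.1 (((core x A a).comp (retraction x A a)).comp f.1)
        (Cube.boundary (Fin n)) := fun f =>
    homotopicRel_core hA (isOpenEmbedding_piMap_sigmoid n) f.1
      (fun p hp => ⟨y₀, (f.2 p (mem_boundary_of_notMem_range_sigmoid hp)).symm⟩)
      (fun p hp => ⟨y₀, (f.2 p hp).symm⟩) y₀
  constructor
  · intro p q
    induction p, q using Quotient.inductionOn₂ with
    | h p q =>
      intro hpq
      have hr : ContinuousMap.HomotopicRel ((retraction x A a).comp p.1)
          ((retraction x A a).comp q.1) (Cube.boundary (Fin n)) := Quotient.exact hpq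
      exact Quotient.sound (((hrel p).trans (hr.comp_continuousMap (core x A a))).trans
        (hrel q).symm)
  · intro q
    induction q using Quotient.inductionOn with
    | h q =>
      exact ⟨Quotient.mk _ (GenLoop.postcomp (core x A a) rfl q),
        congrArg (Quotient.mk _) (GenLoop.ext _ _ fun _ => rfl)⟩

end ShrinkingAdj

end

theorem mainTheorem8 {X : Type*} [TopologicalSpace X] [T2Space X]
    (A : ℕ → Type*) [∀ j, TopologicalSpace (A j)] [∀ j, T2Space (A j)]
    (x : ℕ → X) (a : ∀ j, A j) (n : ℕ)
    (hA : ∀ j, SequentiallyConnectedAt n (A j) (a j)) (y₀ : X) :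
    (∀ f : ℕ → GenLoop (Fin n) (ShrinkingAdj x A a) (ShrinkingAdj.core x A a y₀),
      ConvergesToPoint (fun m => (f m).1) (ShrinkingAdj.core x A a y₀) →
      SequentiallyHomotopicRel (Cube.boundary (Fin n))
        (fun m => (f m).1)
        (fun m => ((ShrinkingAdj.core x A a).comp (ShrinkingAdj.retraction x A a)).comp (f m).1)
        (ShrinkingAdj.core x A a y₀)) ∧
    (SequentiallyConnectedAt n X y₀ →
      SequentiallyConnectedAt n (ShrinkingAdj x A a) (ShrinkingAdj.core x A a y₀)) ∧
    (∀ m ≤ n, Function.Bijective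
      (HomotopyGroup.induced (ShrinkingAdj.retraction x A a)
        (ShrinkingAdj.retraction_core x A a y₀) m)) ∧
    (∀ m, m + 1 ≤ n →
      ∃ e : HomotopyGroup.Pi (m + 1) (ShrinkingAdj x A a) (ShrinkingAdj.core x A a y₀) ≃*
          HomotopyGroup.Pi (m + 1) X y₀,
        ⇑e = HomotopyGroup.induced (ShrinkingAdj.retraction x A a)
          (ShrinkingAdj.retraction_core x A a y₀) (m + 1)) := by
  exact ⟨fun f hf => ShrinkingAdj.sequentiallyHomotopicRel_core hA y₀ f hf,
    fun hX => ShrinkingAdj.sequentiallyConnectedAt_core hA hX,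
    -- The deformation uses the same number for cube dimension and connectivity, hence the passage
    -- to `m` by `mono`.
    fun m hm => ShrinkingAdj.bijective_induced_retraction (fun j => (hA j).mono hm) y₀,
    fun m hm => ⟨MulEquiv.ofBijective (MonoidHom.mk' _ (HomotopyGroup.induced_mul
      (ShrinkingAdj.retraction x A a) (ShrinkingAdj.retraction_core x A a y₀) m))
      (ShrinkingAdj.bijective_induced_retraction (fun j => (hA j).mono hm) y₀), rfl⟩⟩
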